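/- A multi-agent contract setting with $n$ agents is a pair $(f,c)$, where $f:2^{[n]}\to\mathbb R_{\ge 0}$ is a monotone value function with $f(\emptyset)=0$ and $c_i>0$ are individual costs with $0<c_i\le f(\{i\})$ for every agent $i$. The function $f$ is XOS if it is the pointwise maximum of a finite family of nonnegative additive set functions. Write $f(i:S)=f(S\cup\{i\})-f(S\setminus\{i\})$ and $$\rho(S)=\sum_{i\in S}\frac{c_i}{f(i:S)},\qquad w(S)=f(S)-\sum_{i\in S}c_i,\qquad g(S)=(1-\rho(S))f(S),$$ for the total share, the welfare and the principal's utility of a team $S\subseteq[n]$, where $\rho(S)=\infty$ if $f(i:S)=0$ for some $i\in S$. The team $S$ is $b$-feasible if $\rho(S)\le b$ (feasible if $b=1$). For $a\in(0,1]$, an $a$-demand oracle for $f$ is given a price vector $p\in\mathbb R_{\ge0}^n$ and returns a set $D$ such that $f(D)-\sum_{i\in D}p_i\ge a\,f(T)-\sum_{i\in T}p_i$ for all $T\subseteq[n]$; a value oracle is given a set $S$ and returns $f(S)$. **Proposition.** There are a single algorithm and a polynomial $T$ with the following property. For every $a\in(0,1]$ and every $\eta>0$ there is a constant $C>0$, depending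 only on $a$ and $\eta$, such that for every $n$ and every $n$-agent setting $(f,c)$ with an XOS value function $f$, the algorithm, given $n$, $a$ and $c$ as input and access to the value oracle and to an arbitrary $a$-demand oracle of $f$, halts within $T(n)$ steps and outputs a feasible set $U$ such that, for every $b$ with $1\le b\le 2-\eta$, $$\max\{\,w(S) : S\subseteq[n],\ \rho(S)\le b\,\}\;\le\; C\cdot g(U).$$ Here an algorithm is a uniform real-RAM program: it works with arrays of natural numbers (addition, truncated subtraction, comparison, indexing) and arrays of real numbers (addition, subtraction, multiplication, division, square root, comparison; natural-number constants; no rounding). Each operation costs one step; an oracle query costs $n+1$ steps plus the cost of computing the address at which the answer is stored. -/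

import Mathlib

namespace ContractDesign

/-! ## Multi-agent contract settings

The agents are the elements of `Fin n`, teams are finite sets of agents, `f` is the value function
and `c i` is the cost of agent `i`. -/

/-- Marginal contribution `f(i : S) = f(S ∪ {i}) - f(S \ {i})`. -/
def marginal {n : ℕ} (f : Finset (Fin n) → ℝ) (i : Fin n) (S : Finset (Fin n)) : ℝ :=
  f (insert i S) - f (S.erase i)

/-- An additive set function with nonnegative values. -/
def IsAdditive {n : ℕ} (h : Finset (Fin n) → ℝ) : Prop :=
  (∀ S, 0 ≤ h S) ∧ ∀ S, ∀ i, i ∉ S → h (insert i S) = h S + h {i}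

/-- XOS: the pointwise maximum of a finite (nonempty) family of additive functions. -/
def IsXOS {n : ℕ} (f : Finset (Fin n) → ℝ) : Prop :=
  ∃ (k : ℕ) (h : Fin k → Finset (Fin n) → ℝ), (∀ l, IsAdditive (h l)) ∧
    ∀ S, IsGreatest (Set.range fun l => h l S) (f S)

/-- The standing assumptions on a multi-agent contract setting `(f, c)`. -/
structure IsSetting {n : ℕ} (f : Finset (Fin n) → ℝ) (c : Fin n → ℝ) : Prop where
  empty : f ∅ = 0
  mono : ∀ S T : Finset (Fin n), S ⊆ T → f S ≤ f T
  value_pos : ∀ i, 0 < f {i}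
  cost_pos : ∀ i, 0 < c i
  cost_le_value : ∀ i, c i ≤ f {i}

/-- Welfare `w(S) = f(S) - c(S)`. -/
def welfare {n : ℕ} (f : Finset (Fin n) → ℝ) (c : Fin n → ℝ) (S : Finset (Fin n)) : ℝ :=
  f S - ∑ i ∈ S, c i

/-- Some contract incentivizes the team `S`: since costs are positive, this means that every member
has a positive marginal contribution. Otherwise the required share of some member is infinite. -/
def Incentivizable {n : ℕ} (f : Finset (Fin n) → ℝ) (S : Finset (Fin n)) : Prop :=
  ∀ i ∈ S, 0 < marginal f i S

/-- The minimum total share `ρ(S) = ∑ i ∈ S, c i / f(i : S)` needed to incentivize `S`;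
meaningful for incentivizable teams only. -/
noncomputable def share {n : ℕ} (f : Finset (Fin n) → ℝ) (c : Fin n → ℝ)
    (S : Finset (Fin n)) : ℝ :=
  ∑ i ∈ S, c i / marginal f i S

/-- `b`-feasibility: `ρ(S) ≤ b`, where `ρ(S)` is infinite if `S` is not incentivizable. -/
def BFeasible {n : ℕ} (f : Finset (Fin n) → ℝ) (c : Fin n → ℝ) (b : ℝ)
    (S : Finset (Fin n)) : Prop :=
  Incentivizable f S ∧ share f c S ≤ b

/-- The principal's utility `g(S) = (1 - ρ(S)) f(S)`; meaningful for incentivizable teams only. -/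
noncomputable def utility {n : ℕ} (f : Finset (Fin n) → ℝ) (c : Fin n → ℝ)
    (S : Finset (Fin n)) : ℝ :=
  (1 - share f c S) * f S

/-- The optimal welfare subject to `b`-feasibility. -/
noncomputable def optWelfare {n : ℕ} (f : Finset (Fin n) → ℝ) (c : Fin n → ℝ) (b : ℝ) : ℝ :=
  sSup {x | ∃ S, BFeasible f c b S ∧ welfare f c S = x}

/-- The supremum in `optWelfare` is an attained maximum. -/
theorem isGreatest_optWelfare {n : ℕ} (f : Finset (Fin n) → ℝ) (c : Fin n → ℝ) {b : ℝ}
    (hb : 0 ≤ b) :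
    IsGreatest {x | ∃ S, BFeasible f c b S ∧ welfare f c S = x} (optWelfare f c b) := by
  have hne : {x | ∃ S, BFeasible f c b S ∧ welfare f c S = x}.Nonempty :=
    ⟨_, ∅, ⟨by simp [Incentivizable], by simpa [share] using hb⟩, rfl⟩
  have hfin : {x | ∃ S, BFeasible f c b S ∧ welfare f c S = x}.Finite :=
    (Set.finite_range (welfare f c)).subset (by rintro x ⟨S, -, rfl⟩; exact ⟨S, rfl⟩)
  exact ⟨hne.csSup_mem hfin, fun x hx => le_csSup hfin.bddAbove hx⟩

/-- `dem` is an `a`-demand oracle for `f`: on every vector `p` of nonnegative prices it returns a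
set `D` with `f(D) - p(D) ≥ a f(T) - p(T)` for all `T`. -/
def IsDemandOracle {n : ℕ} (a : ℝ) (f : Finset (Fin n) → ℝ)
    (dem : (Fin n → ℝ) → Finset (Fin n)) : Prop :=
  ∀ p : Fin n → ℝ, (∀ i, 0 ≤ p i) → ∀ T : Finset (Fin n),
    a * f T - ∑ i ∈ T, p i ≤ f (dem p) - ∑ i ∈ dem p, p i

/-! ## Real-RAM programs with oracles

A program works on arrays of natural numbers (used for counters, indices and sets) and arrays of
real numbers. Each arithmetic operation, memory access and comparison is charged one unit. Natural
numbers can be added and subtracted (truncated). Reals can be added, subtracted, multiplied,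
divided (with `x / 0 = 0`), compared, and square roots can be taken (with `√x = 0` for `x < 0`);
there is no rounding and no conversion of reals to natural numbers. The only constants are natural
numbers. -/

/-- Memory: `nat k j` and `real k j` are the cells with index `j` of the `k`-th arrays. -/
structure State where
  nat : ℕ → ℕ → ℕ
  real : ℕ → ℕ → ℝ

/-- Expressions for natural numbers. -/
inductive NExpr where
  | const (m : ℕ)
  | get (k : ℕ) (j : NExpr)
  | add (e₁ e₂ : NExpr)
  | sub (e₁ e₂ : NExpr)

/-- Expressions for real numbers. -/
inductive RExpr where
  | const (m : ℕ)
  | get (k : ℕ) (j : NExpr)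
  | add (e₁ e₂ : RExpr)
  | sub (e₁ e₂ : RExpr)
  | mul (e₁ e₂ : RExpr)
  | div (e₁ e₂ : RExpr)
  | sqrt (e : RExpr)

/-- Tests. -/
inductive BExpr where
  | natLt (e₁ e₂ : NExpr)
  | realLt (e₁ e₂ : RExpr)
  | neg (t : BExpr)
  | conj (t₁ t₂ : BExpr)

def NExpr.eval (σ : State) : NExpr → ℕ
  | .const m => m
  | .get k j => σ.nat k (j.eval σ)
  | .add e₁ e₂ => e₁.eval σ + e₂.eval σ
  | .sub e₁ e₂ => e₁.eval σ - e₂.eval σ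

noncomputable def RExpr.eval (σ : State) : RExpr → ℝ
  | .const m => m
  | .get k j => σ.real k (j.eval σ)
  | .add e₁ e₂ => e₁.eval σ + e₂.eval σ
  | .sub e₁ e₂ => e₁.eval σ - e₂.eval σ
  | .mul e₁ e₂ => e₁.eval σ * e₂.eval σ
  | .div e₁ e₂ => e₁.eval σ / e₂.eval σ
  | .sqrt e => Real.sqrt (e.eval σ)

def BExpr.holds (σ : State) : BExpr → Prop
  | .natLt e₁ e₂ => e₁.eval σ < e₂.eval σ
  | .realLt e₁ e₂ => e₁.eval σ < e₂.eval σ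
  | .neg t => ¬ t.holds σ
  | .conj t₁ t₂ => t₁.holds σ ∧ t₂.holds σ

/-- The cost of evaluating an expression is its number of nodes. -/
def NExpr.cost : NExpr → ℕ
  | .const _ => 1
  | .get _ j => j.cost + 1
  | .add e₁ e₂ => e₁.cost + e₂.cost + 1
  | .sub e₁ e₂ => e₁.cost + e₂.cost + 1

def RExpr.cost : RExpr → ℕ
  | .const _ => 1
  | .get _ j => j.cost + 1
  | .add e₁ e₂ => e₁.cost + e₂.cost + 1
  | .sub e₁ e₂ => e₁.cost + e₂.cost + 1
  | .mul e₁ e₂ => e₁.cost + e₂.cost + 1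
  | .div e₁ e₂ => e₁.cost + e₂.cost + 1
  | .sqrt e => e.cost + 1

def BExpr.cost : BExpr → ℕ
  | .natLt e₁ e₂ => e₁.cost + e₂.cost + 1
  | .realLt e₁ e₂ => e₁.cost + e₂.cost + 1
  | .neg t => t.cost + 1
  | .conj t₁ t₂ => t₁.cost + t₂.cost + 1

/-- Programs.
* `setNat k j e` and `setReal k j e` write the value of `e` into cell `j` of the `k`-th array;
* `value k j s` queries the value oracle at the set stored in the natural-number array `s` and
  writes the answer into cell `j` of the real array `k`;
* `demand s p` queries the demand oracle at the price vector stored in the real array `p` and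
  stores the answer in the natural-number array `s`. -/
inductive Program where
  | skip
  | setNat (k : ℕ) (j e : NExpr)
  | setReal (k : ℕ) (j : NExpr) (e : RExpr)
  | value (k : ℕ) (j : NExpr) (s : ℕ)
  | demand (s p : ℕ)
  | seq (P Q : Program)
  | ite (t : BExpr) (P Q : Program)
  | loop (t : BExpr) (P : Program)

/-- Overwrite cell `j` of the `k`-th natural-number array. -/
def State.writeNat (σ : State) (k j v : ℕ) : State :=
  { σ with nat := fun k' j' => if k' = k ∧ j' = j then v else σ.nat k' j' }

/-- Overwrite cell `j` of the `k`-th real array. -/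
noncomputable def State.writeReal (σ : State) (k j : ℕ) (v : ℝ) : State :=
  { σ with real := fun k' j' => if k' = k ∧ j' = j then v else σ.real k' j' }

/-- The set of agents stored in the `s`-th natural-number array: nonzero entries are members. -/
def State.readSet (σ : State) (n s : ℕ) : Finset (Fin n) :=
  Finset.univ.filter fun i => σ.nat s i ≠ 0

/-- The vector stored in the first `n` cells of the `p`-th real array. -/
def State.readVec (σ : State) (n p : ℕ) : Fin n → ℝ :=
  fun i => σ.real p i

/-- Store a set of agents as a `0`-`1` vector in the first `n` cells of array `s`. -/
def State.writeSet (σ : State) {n : ℕ} (s : ℕ) (D : Finset (Fin n)) : State :=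
  { σ with nat := fun k j =>
      if h : k = s ∧ j < n then (if (⟨j, h.2⟩ : Fin n) ∈ D then 1 else 0) else σ.nat k j }

/-- `Exec val dem P σ t τ`: with value oracle `val` and demand oracle `dem`, the program `P` started
in `σ` halts in `τ` after `t` time units. An oracle query takes `n + 1` units (plus the cost of the
address of the answer). -/
inductive Exec {n : ℕ} (val : Finset (Fin n) → ℝ) (dem : (Fin n → ℝ) → Finset (Fin n)) :
    Program → State → ℕ → State → Prop where
  | skip (σ : State) : Exec val dem .skip σ 1 σ
  | setNat (σ : State) (k : ℕ) (j e : NExpr) :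
      Exec val dem (.setNat k j e) σ (j.cost + e.cost + 1)
        (σ.writeNat k (j.eval σ) (e.eval σ))
  | setReal (σ : State) (k : ℕ) (j : NExpr) (e : RExpr) :
      Exec val dem (.setReal k j e) σ (j.cost + e.cost + 1)
        (σ.writeReal k (j.eval σ) (e.eval σ))
  | value (σ : State) (k : ℕ) (j : NExpr) (s : ℕ) :
      Exec val dem (.value k j s) σ (j.cost + n + 1)
        (σ.writeReal k (j.eval σ) (val (σ.readSet n s)))
  | demand (σ : State) (s p : ℕ) :
      Exec val dem (.demand s p) σ (n + 1) (σ.writeSet s (dem (σ.readVec n p)))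
  | seq {P Q : Program} {σ₀ σ₁ σ₂ : State} {t₁ t₂ : ℕ} :
      Exec val dem P σ₀ t₁ σ₁ → Exec val dem Q σ₁ t₂ σ₂ →
        Exec val dem (.seq P Q) σ₀ (t₁ + t₂) σ₂
  | iteTrue {t : BExpr} {P Q : Program} {σ τ : State} {k : ℕ} :
      t.holds σ → Exec val dem P σ k τ → Exec val dem (.ite t P Q) σ (t.cost + 1 + k) τ
  | iteFalse {t : BExpr} {P Q : Program} {σ τ : State} {k : ℕ} :
      ¬ t.holds σ → Exec val dem Q σ k τ → Exec val dem (.ite t P Q) σ (t.cost + 1 + k) τ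
  | loopStop {t : BExpr} {P : Program} {σ : State} :
      ¬ t.holds σ → Exec val dem (.loop t P) σ (t.cost + 1) σ
  | loopStep {t : BExpr} {P : Program} {σ₀ σ₁ σ₂ : State} {k₁ k₂ : ℕ} :
      t.holds σ₀ → Exec val dem P σ₀ k₁ σ₁ → Exec val dem (.loop t P) σ₁ k₂ σ₂ →
        Exec val dem (.loop t P) σ₀ (t.cost + 1 + k₁ + k₂) σ₂

/-- Programs are deterministic: the final state and the running time are unique. -/
theorem Exec.deterministic {n : ℕ} {val : Finset (Fin n) → ℝ}
    {dem : (Fin n → ℝ) → Finset (Fin n)} {P : Program} {σ τ τ' : State} {k k' : ℕ}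
    (h : Exec val dem P σ k τ) (h' : Exec val dem P σ k' τ') : k = k' ∧ τ = τ' := by
  induction h generalizing k' τ' with
  | skip | setNat | setReal | value | demand => cases h'; exact ⟨rfl, rfl⟩
  | seq _ _ ih₁ ih₂ =>
    cases h' with
    | seq h₁ h₂ =>
      obtain ⟨rfl, rfl⟩ := ih₁ h₁
      obtain ⟨rfl, rfl⟩ := ih₂ h₂
      exact ⟨rfl, rfl⟩
  | iteTrue ht _ ih =>
    cases h' with
    | iteTrue _ h₁ => obtain ⟨rfl, rfl⟩ := ih h₁; exact ⟨rfl, rfl⟩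
    | iteFalse hf _ => exact absurd ht hf
  | iteFalse hf _ ih =>
    cases h' with
    | iteTrue ht _ => exact absurd ht hf
    | iteFalse _ h₁ => obtain ⟨rfl, rfl⟩ := ih h₁; exact ⟨rfl, rfl⟩
  | loopStop hf =>
    cases h' with
    | loopStop _ => exact ⟨rfl, rfl⟩
    | loopStep ht _ _ => exact absurd ht hf
  | loopStep ht _ _ ih₁ ih₂ =>
    cases h' with
    | loopStop hf => exact absurd ht hf
    | loopStep _ h₁ h₂ =>
      obtain ⟨rfl, rfl⟩ := ih₁ h₁
      obtain ⟨rfl, rfl⟩ := ih₂ h₂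
      exact ⟨rfl, rfl⟩

/-- The input: `n` in cell `0` of natural-number array `0`, the oracle quality `a` in cell `0` of
real array `0`, the costs in the first `n` cells of real array `1`, and zeros elsewhere. -/
noncomputable def inputState {n : ℕ} (a : ℝ) (c : Fin n → ℝ) : State where
  nat := fun k j => if k = 0 ∧ j = 0 then n else 0
  real := fun k j =>
    if k = 0 ∧ j = 0 then a
    else if h : k = 1 ∧ j < n then c ⟨j, h.2⟩
    else 0

/-- With the value oracle `f` and the demand oracle `dem`, on input `(n, a, c)`, the program `P`
halts within `T` time units with the set `U` stored in natural-number array `1`. -/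
def Outputs {n : ℕ} (P : Program) (f : Finset (Fin n) → ℝ) (dem : (Fin n → ℝ) → Finset (Fin n))
    (a : ℝ) (c : Fin n → ℝ) (T : ℕ) (U : Finset (Fin n)) : Prop :=
  ∃ (t : ℕ) (τ : State), Exec f dem P (inputState a c) t τ ∧ t ≤ T ∧ τ.readSet n 1 = U

end ContractDesign

/-! Let `S` have total share at most `b ≤ 2 - η`. At most one member `e` has a share above `1 - η /
2` (`BFeasible.exists_subset`). Its contribution to the welfare is at most `f {e} - c e`, the
utility of a single-agent team, so it remains to bound the value of the rest `S'`. Let `j` be a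
member of `S'` with the largest singleton value. Since `c j ≤ (1 - η / 2) f {j}`, the team `{j}` has
utility of order `η f {j}`, which is enough unless `f S'` exceeds a large multiple of `f {j} / a²`.

In that case Cauchy–Schwarz turns the share bound into `(∑ √(c i))² ≤ 2 f S'`. Suppose `Y ≤ f S' ≤ 2
Y` and give each agent the price `q i = (a / 3) √(c i * Y)`. Then `S'` costs at most half of `a f
S'`, so a demand set is worth at least the other half. Deleting agents whose marginal contribution
is below their price never lowers value minus price, and ends in a set `D'` with all marginals at
least the prices. Marginals are dominated by a supporting additive function, so every `T ⊆ D'`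
satisfies `q(T) ≤ f T` (`IsSetting.sum_price_le`); this takes the place of submodularity.

Because `c i / q i` is proportional to `q i`, a team `U ⊆ D'` with marginals at least `q i / 2` has
share at most a constant times `f U / (a² Y)`. Hence agents are deleted from `D'` until the value is
about `a² Y / 72`; each deletion loses at most `f {j}`, since agents more valuable than `j` are
priced out. Deletions can destroy the marginals, but deleting again with halved prices restores them
and keeps at least half of the value. The resulting team has share at most `1 / 4`
(`GuessGood.of_steps`).

The ratio `f S' / f {j}` lies between `1` and `n`, so some `Y = k f {j}` with `1 ≤ k ≤ n` is a
correct guess. All pairs `(j, k)` and all single agents are tried and the best team is kept.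
`welfare_le` combines the cases; `contractProgram_runs` shows that the program does all this in
polynomial time. -/

namespace ContractDesign

/-! ## Reasoning about programs -/

section Semantics

/-- The program contains an instruction that writes to the `l`-th natural-number array. -/
def Program.WritesNat : Program → ℕ → Prop
  | .skip, _ => False
  | .setNat k _ _, l => l = k
  | .setReal _ _ _, _ => False
  | .value _ _ _, _ => False
  | .demand s _, l => l = s
  | .seq P Q, l => P.WritesNat l ∨ Q.WritesNat l
  | .ite _ P Q, l => P.WritesNat l ∨ Q.WritesNat l
  | .loop _ P, l => P.WritesNat l

/-- The program contains an instruction that writes to the `l`-th real array. -/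
def Program.WritesReal : Program → ℕ → Prop
  | .skip, _ => False
  | .setNat _ _ _, _ => False
  | .setReal k _ _, l => l = k
  | .value k _ _, l => l = k
  | .demand _ _, _ => False
  | .seq P Q, l => P.WritesReal l ∨ Q.WritesReal l
  | .ite _ P Q, l => P.WritesReal l ∨ Q.WritesReal l
  | .loop _ P, l => P.WritesReal l

/-- The states `σ` and `τ` agree on all arrays to which `P` does not write. -/
structure Frame (P : Program) (σ τ : State) : Prop where
  nat : ∀ l, ¬ P.WritesNat l → τ.nat l = σ.nat l
  real : ∀ l, ¬ P.WritesReal l → τ.real l = σ.real l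

theorem Frame.refl (P : Program) (σ : State) : Frame P σ σ := ⟨fun _ _ => rfl, fun _ _ => rfl⟩

theorem Frame.trans {P : Program} {σ₀ σ₁ σ₂ : State} (h₁ : Frame P σ₀ σ₁) (h₂ : Frame P σ₁ σ₂) :
    Frame P σ₀ σ₂ :=
  ⟨fun l hl => (h₂.nat l hl).trans (h₁.nat l hl), fun l hl => (h₂.real l hl).trans (h₁.real l hl)⟩

theorem Frame.mono {P Q : Program} {σ τ : State} (h : Frame P σ τ)
    (hn : ∀ l, P.WritesNat l → Q.WritesNat l) (hr : ∀ l, P.WritesReal l → Q.WritesReal l) :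
    Frame Q σ τ :=
  ⟨fun l hl => h.nat l (mt (hn l) hl), fun l hl => h.real l (mt (hr l) hl)⟩

/-! ### Reading memory after writing to it. -/

@[simp] theorem State.writeNat_nat (σ : State) (k j v k' j' : ℕ) :
    (σ.writeNat k j v).nat k' j' = if k' = k ∧ j' = j then v else σ.nat k' j' := rfl

@[simp] theorem State.writeNat_real (σ : State) (k j v : ℕ) :
    (σ.writeNat k j v).real = σ.real := rfl

@[simp] theorem State.writeReal_nat (σ : State) (k j : ℕ) (v : ℝ) :
    (σ.writeReal k j v).nat = σ.nat := rfl

@[simp] theorem State.writeReal_real (σ : State) (k j : ℕ) (v : ℝ) (k' j' : ℕ) :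
    (σ.writeReal k j v).real k' j' = if k' = k ∧ j' = j then v else σ.real k' j' := rfl

theorem State.mem_readSet {σ : State} {n s : ℕ} {i : Fin n} :
    i ∈ σ.readSet n s ↔ σ.nat s i ≠ 0 := by
  simp [State.readSet]

theorem State.readSet_congr {σ τ : State} {s : ℕ} (h : τ.nat s = σ.nat s) (n : ℕ) :
    τ.readSet n s = σ.readSet n s := by
  simp [State.readSet, h]

theorem State.readVec_congr {σ τ : State} {p : ℕ} (h : τ.real p = σ.real p) (n : ℕ) :
    τ.readVec n p = σ.readVec n p := by
  funext i
  simp [State.readVec, h]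

@[simp] theorem State.readSet_writeReal (σ : State) (k j : ℕ) (v : ℝ) (n s : ℕ) :
    (σ.writeReal k j v).readSet n s = σ.readSet n s := rfl

theorem State.writeNat_nat_of_ne (σ : State) {k j v s : ℕ} (h : s ≠ k) :
    (σ.writeNat k j v).nat s = σ.nat s := by
  funext j'
  simp [h]

theorem State.writeReal_real_of_ne (σ : State) {k j s : ℕ} {v : ℝ} (h : s ≠ k) :
    (σ.writeReal k j v).real s = σ.real s := by
  funext j'
  simp [h]

@[simp] theorem State.readSet_writeNat_of_ne (σ : State) {k j v s : ℕ} (h : s ≠ k) (n : ℕ) :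
    (σ.writeNat k j v).readSet n s = σ.readSet n s :=
  State.readSet_congr (σ.writeNat_nat_of_ne h) n

@[simp] theorem State.readSet_writeNat_zero (σ : State) {n : ℕ} (s : ℕ) (i : Fin n) :
    (σ.writeNat s i 0).readSet n s = (σ.readSet n s).erase i := by
  ext x
  simp [State.mem_readSet, Fin.ext_iff]

@[simp] theorem State.readSet_writeNat_one (σ : State) {n : ℕ} (s : ℕ) (i : Fin n) :
    (σ.writeNat s i 1).readSet n s = insert i (σ.readSet n s) := by
  ext x
  by_cases h : (x : ℕ) = i <;> simp [State.mem_readSet, Fin.ext_iff, h]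

@[simp] theorem State.readSet_writeSet (σ : State) {n : ℕ} (s : ℕ) (D : Finset (Fin n)) :
    (σ.writeSet s D).readSet n s = D := by
  ext x
  simp [State.mem_readSet, State.writeSet]

theorem State.writeSet_nat_of_ne (σ : State) {n : ℕ} {s k : ℕ} (D : Finset (Fin n)) (h : k ≠ s) :
    (σ.writeSet s D).nat k = σ.nat k := by
  funext j
  simp [State.writeSet, h]

variable {n : ℕ} {val : Finset (Fin n) → ℝ} {dem : (Fin n → ℝ) → Finset (Fin n)}

/-- Which arrays may change can be read off the syntax, so facts about all other arrays survive any
execution without a separate invariant. -/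
theorem Exec.frame {P : Program} {σ τ : State} {t : ℕ} (h : Exec val dem P σ t τ) :
    Frame P σ τ := by
  induction h with
  | skip σ => exact .refl _ _
  | setNat σ k j e => exact ⟨fun l hl => σ.writeNat_nat_of_ne hl, fun _ _ => rfl⟩
  | setReal σ k j e => exact ⟨fun _ _ => rfl, fun l hl => σ.writeReal_real_of_ne hl⟩
  | value σ k j s => exact ⟨fun _ _ => rfl, fun l hl => σ.writeReal_real_of_ne hl⟩
  | demand σ s p => exact ⟨fun l hl => σ.writeSet_nat_of_ne _ hl, fun _ _ => rfl⟩
  | seq _ _ ih₁ ih₂ =>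
    exact (ih₁.mono (fun _ => Or.inl) fun _ => Or.inl).trans
      (ih₂.mono (fun _ => Or.inr) fun _ => Or.inr)
  | iteTrue _ _ ih => exact ih.mono (fun _ => Or.inl) fun _ => Or.inl
  | iteFalse _ _ ih => exact ih.mono (fun _ => Or.inr) fun _ => Or.inr
  | loopStop => exact .refl _ _
  | loopStep _ _ _ ih₁ ih₂ => exact .trans (ih₁.mono (fun _ h => h) fun _ h => h) ih₂

/-- Started in `σ`, the program `P` halts within `B(n)` steps in a state that satisfies `Q`. -/
def Runs (val : Finset (Fin n) → ℝ) (dem : (Fin n → ℝ) → Finset (Fin n)) (P : Program) (σ : State)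
    (B : Polynomial ℕ) (Q : State → Prop) : Prop :=
  ∃ t τ, Exec val dem P σ t τ ∧ t ≤ B.eval n ∧ Q τ

/-! ### Hoare-style rules with polynomial time bounds. -/

variable {P P₁ P₂ : Program} {σ : State} {B B₁ B₂ : Polynomial ℕ} {Q Q₁ Q₂ : State → Prop}

theorem Runs.imp (h : Runs val dem P σ B Q₁) (hQ : ∀ τ, Frame P σ τ → Q₁ τ → Q₂ τ) :
    Runs val dem P σ B Q₂ := by
  obtain ⟨t, τ, he, ht, hq⟩ := h
  exact ⟨t, τ, he, ht, hQ τ he.frame hq⟩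

theorem Runs.seq (h₁ : Runs val dem P₁ σ B₁ Q₁)
    (h₂ : ∀ τ, Frame P₁ σ τ → Q₁ τ → Runs val dem P₂ τ B₂ Q₂) :
    Runs val dem (.seq P₁ P₂) σ (B₁ + B₂) Q₂ := by
  obtain ⟨t₁, τ₁, he₁, ht₁, hq₁⟩ := h₁
  obtain ⟨t₂, τ₂, he₂, ht₂, hq₂⟩ := h₂ τ₁ he₁.frame hq₁
  exact ⟨_, _, .seq he₁ he₂, by rw [Polynomial.eval_add]; exact add_le_add ht₁ ht₂, hq₂⟩

/-- The bounds of the two branches are added, a sum being a polynomial that dominates both. -/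
theorem Runs.ite {t : BExpr} (h₁ : t.holds σ → Runs val dem P₁ σ B₁ Q)
    (h₂ : ¬ t.holds σ → Runs val dem P₂ σ B₂ Q) :
    Runs val dem (.ite t P₁ P₂) σ (.C (t.cost + 1) + (B₁ + B₂)) Q := by
  by_cases ht : t.holds σ
  · obtain ⟨k, τ, he, hk, hq⟩ := h₁ ht
    exact ⟨_, _, .iteTrue ht he, by simp only [Polynomial.eval_add, Polynomial.eval_C]; omega, hq⟩
  · obtain ⟨k, τ, he, hk, hq⟩ := h₂ ht
    exact ⟨_, _, .iteFalse ht he, by simp only [Polynomial.eval_add, Polynomial.eval_C]; omega, hq⟩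

/-- A loop whose body decreases a measure `μ` and preserves an invariant `I`. -/
theorem Runs.loop {t : BExpr} {I : State → Prop} {μ : State → ℕ} {N : Polynomial ℕ}
    (hI : I σ) (hμ : μ σ ≤ N.eval n)
    (body : ∀ σ, I σ → t.holds σ → Runs val dem P σ B fun τ => I τ ∧ μ τ < μ σ) :
    Runs val dem (.loop t P) σ ((N + 1) * (.C (t.cost + 1) + B))
      fun τ => I τ ∧ ¬ t.holds τ := by
  have key : ∀ m σ, I σ → μ σ ≤ m → ∃ k τ, Exec val dem (.loop t P) σ k τ ∧
      k ≤ (m + 1) * (t.cost + 1 + B.eval n) ∧ I τ ∧ ¬ t.holds τ := by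
    intro m
    induction m with
    | zero =>
      intro σ hI hm
      by_cases ht : t.holds σ
      · obtain ⟨_, _, _, _, _, hlt⟩ := body σ hI ht
        omega
      · exact ⟨_, σ, .loopStop ht, by omega, hI, ht⟩
    | succ m ih =>
      intro σ hI hm
      by_cases ht : t.holds σ
      · obtain ⟨k₁, τ₁, he₁, hk₁, hI₁, hlt⟩ := body σ hI ht
        obtain ⟨k₂, τ₂, he₂, hk₂, h₂⟩ := ih τ₁ hI₁ (by omega)
        refine ⟨_, _, .loopStep ht he₁ he₂, ?_, h₂⟩
        calc t.cost + 1 + k₁ + k₂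
            ≤ (t.cost + 1 + B.eval n) + (m + 1) * (t.cost + 1 + B.eval n) := by omega
          _ = _ := by ring
      · exact ⟨_, σ, .loopStop ht, by nlinarith, hI, ht⟩
  obtain ⟨k, τ, he, hk, h⟩ := key _ σ hI hμ
  exact ⟨k, τ, he, by simpa using hk, h⟩

/-- Run `P` for all values `0, …, n - 1` of the counter in cell `0` of array `v`. -/
def forLoop (v : ℕ) (P : Program) : Program :=
  .seq (.setNat v (.const 0) (.const 0))
    (.loop (.natLt (.get v (.const 0)) (.get 0 (.const 0)))
      (.seq P (.setNat v (.const 0) (.add (.get v (.const 0)) (.const 1)))))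

/-- The running time of `forLoop v P` if each run of `P` takes time `B`. -/
noncomputable def forTime (B : Polynomial ℕ) : Polynomial ℕ :=
  -- Initialization costs 3, and each test and each increment of the counter costs 6.
  .C 3 + (.X + 1) * (.C 6 + (B + .C 6))

@[simp] theorem forLoop_writesNat (v : ℕ) (P : Program) (l : ℕ) :
    (forLoop v P).WritesNat l ↔ l = v ∨ P.WritesNat l := by
  simp only [forLoop, Program.WritesNat]; tauto

@[simp] theorem forLoop_writesReal (v : ℕ) (P : Program) (l : ℕ) :
    (forLoop v P).WritesReal l ↔ P.WritesReal l := by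
  simp [forLoop, Program.WritesReal]

/-- The invariant is indexed by the number of completed rounds and must not depend on the counter
cell, which changes between rounds. The body may also use the frame relative to the start of the
whole loop, so invariants need only mention arrays that the loop writes. -/
theorem Runs.forLoop {v : ℕ} (hv : v ≠ 0) (h0 : ¬ P.WritesNat 0) (hPv : ¬ P.WritesNat v)
    (hn : σ.nat 0 0 = n) {I : ℕ → State → Prop}
    (hI : ∀ i w τ, I i τ → I i (τ.writeNat v 0 w)) (init : I 0 σ)
    (body : ∀ i : Fin n, ∀ τ, τ.nat v 0 = i.val → Frame (forLoop v P) σ τ → I i τ →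
      Runs val dem P τ B (I (i.val + 1))) :
    Runs val dem (ContractDesign.forLoop v P) σ (forTime B) (I n) := by
  have hframe : ∀ (τ : State) (w : ℕ), Frame (ContractDesign.forLoop v P) τ (τ.writeNat v 0 w) :=
    fun τ w => ⟨fun l hl => τ.writeNat_nat_of_ne fun h => hl (by simp [h]), fun _ _ => rfl⟩
  have hnat : ∀ τ, Frame (ContractDesign.forLoop v P) σ τ → τ.nat 0 0 = n := fun τ hτ => by
    rw [hτ.nat 0 (by simp [h0, hv.symm]), hn]
  refine Runs.seq (B₁ := .C 3)
    (Q₁ := fun τ => Frame (ContractDesign.forLoop v P) σ τ ∧ τ.nat v 0 = 0 ∧ I 0 τ)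
    ⟨_, _, .setNat σ _ _ _, by simp [NExpr.cost], hframe σ _, by simp [NExpr.eval], hI _ _ _ init⟩
    fun τ _ hτ => ?_
  have hloop := Runs.loop (val := val) (dem := dem) (n := n) (σ := τ) (N := .X) (B := B + .C 6)
    (P := .seq P (.setNat v (.const 0) (.add (.get v (.const 0)) (.const 1))))
    (t := .natLt (.get v (.const 0)) (.get 0 (.const 0)))
    (I := fun τ => Frame (ContractDesign.forLoop v P) σ τ ∧ τ.nat v 0 ≤ n ∧ I (τ.nat v 0) τ)
    (μ := fun τ => n - τ.nat v 0)
    ⟨hτ.1, by omega, by rw [hτ.2.1]; exact hτ.2.2⟩ (by simp)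
    (by
      rintro ρ ⟨hρ, -, hρI⟩ hlt
      simp only [BExpr.holds, NExpr.eval, hnat ρ hρ] at hlt
      refine Runs.seq (body ⟨_, hlt⟩ ρ rfl hρ hρI) fun ρ' hf hI' => ?_
      have hv' : ρ'.nat v 0 = ρ.nat v 0 := by rw [hf.nat v hPv]
      have hρ' : Frame (ContractDesign.forLoop v P) σ ρ' :=
        hρ.trans (hf.mono (fun l hl => by simp [hl]) fun l hl => by simp [hl])
      refine ⟨_, _, .setNat ρ' _ _ _, by simp [NExpr.cost], ⟨hρ'.trans (hframe ρ' _), ?_, ?_⟩, ?_⟩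
      · simp [NExpr.eval, hv']; omega
      · simpa [NExpr.eval, hv'] using hI _ _ _ hI'
      · simp [NExpr.eval, hv']; omega)
  refine hloop.imp fun ρ _ h => ?_
  obtain ⟨⟨hρ, hle, hρI⟩, hnlt⟩ := h
  simp only [BExpr.holds, NExpr.eval, hnat ρ hρ] at hnlt
  rwa [show ρ.nat v 0 = n by omega] at hρI

/-! ### Loop-free programs, evaluated as functions on states. -/

/-- The program contains no loops. -/
def Program.LoopFree : Program → Prop
  | .seq P Q => P.LoopFree ∧ Q.LoopFree
  | .ite _ P Q => P.LoopFree ∧ Q.LoopFree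
  | .loop _ _ => False
  | _ => True

open Classical in
/-- The final state of a loop-free program. -/
noncomputable def Program.run (val : Finset (Fin n) → ℝ) (dem : (Fin n → ℝ) → Finset (Fin n)) :
    Program → State → State
  | .skip, σ => σ
  | .setNat k j e, σ => σ.writeNat k (j.eval σ) (e.eval σ)
  | .setReal k j e, σ => σ.writeReal k (j.eval σ) (e.eval σ)
  | .value k j s, σ => σ.writeReal k (j.eval σ) (val (σ.readSet n s))
  | .demand s p, σ => σ.writeSet s (dem (σ.readVec n p))
  | .seq P Q, σ => Q.run val dem (P.run val dem σ)
  | .ite t P Q, σ => if t.holds σ then P.run val dem σ else Q.run val dem σ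
  | .loop _ _, σ => σ

/-- A bound for the running time of a loop-free program. -/
noncomputable def Program.time : Program → Polynomial ℕ
  | .skip => 1
  | .setNat _ j e => .C (j.cost + e.cost + 1)
  | .setReal _ j e => .C (j.cost + e.cost + 1)
  | .value _ j _ => .C j.cost + .X + 1
  | .demand _ _ => .X + 1
  | .seq P Q => P.time + Q.time
  | .ite t P Q => .C (t.cost + 1) + (P.time + Q.time)
  | .loop _ _ => 0

theorem Program.LoopFree.exec (h : P.LoopFree) (σ : State) :
    Runs val dem P σ P.time (· = P.run val dem σ) := by
  induction P generalizing σ with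
  | skip => exact ⟨_, _, .skip σ, by simp [time], rfl⟩
  | setNat k j e => exact ⟨_, _, .setNat σ k j e, by simp [time], rfl⟩
  | setReal k j e => exact ⟨_, _, .setReal σ k j e, by simp [time], rfl⟩
  | value k j s => exact ⟨_, _, .value σ k j s, by simp [time], rfl⟩
  | demand s p => exact ⟨_, _, .demand σ s p, by simp [time], rfl⟩
  | seq P Q ihP ihQ =>
    exact (ihP h.1 σ).seq fun τ _ hτ => by simpa [run, hτ] using ihQ h.2 τ
  | ite t P Q ihP ihQ =>
    exact .ite (fun ht => by simpa [run, ht] using ihP h.1 σ)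
      fun ht => by simpa [run, ht] using ihQ h.2 σ
  | loop => exact h.elim

theorem Program.LoopFree.runs (h : P.LoopFree) (hQ : Q (P.run val dem σ)) :
    Runs val dem P σ P.time Q :=
  (h.exec σ).imp fun _ _ hτ => hτ ▸ hQ

end Semantics

/-! ## The algorithm

Natural-number arrays: `0` the number of agents, `1` the best team so far, `2` the current team,
`4`, `5`, `6` counters. Real arrays: `0` the oracle quality, `1` the costs, `2` the prices,
`3` answers to value queries, `4` the share of the current team, `5` the values of single agents,
`6` the utility of the best team, `7` the guess for the value of an optimal team. -/

section Programs

/-- The value of the counter stored in array `v`. -/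
abbrev counter (v : ℕ) : NExpr := .get v (.const 0)

/-- The scalar stored in real array `k`. -/
abbrev scalar (k : ℕ) : RExpr := .get k (.const 0)

/-- Query the value of the current team and its value without the agent given by counter `4`, which
is then removed from the current team. -/
def removeProgram : Program :=
  .seq (.value 3 (.const 0) 2)
    (.seq (.setNat 2 (counter 4) (.const 0)) (.value 3 (.const 1) 2))

/-- The marginal contribution after running `removeProgram`. -/
def marginalExpr : RExpr := .sub (.get 3 (.const 0)) (.get 3 (.const 1))

/-- Put the agent given by counter `4` into the current team. -/
def insertProgram : Program := .setNat 2 (counter 4) (.const 1)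

def incrProgram : Program := .setNat 4 (.const 0) (.add (counter 4) (.const 1))

/-- The agent given by counter `4` is in the current team. -/
def memTest : BExpr := .natLt (.const 0) (.get 2 (counter 4))

/-- A removal sends the scan back to agent `0`: without submodularity it can lower the marginal
contributions of agents that have already passed the test. -/
def cleanBody : Program :=
  .ite memTest
    (.seq removeProgram
      (.ite (.realLt marginalExpr (.get 2 (counter 4)))
        (.setNat 4 (.const 0) (.const 0))
        (.seq insertProgram incrProgram)))
    incrProgram

/-- Remove agents whose marginal contribution is below their price, as long as there are any. -/
def cleanProgram : Program :=
  .seq (.setNat 4 (.const 0) (.const 0)) (.loop (.natLt (counter 4) (counter 0)) cleanBody)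

/-- The threshold is chosen for the share bound: prices adding up to at most `a² Y / 72` give a
share of at most `18 / 72 = 1 / 4`. -/
def shrinkBody : Program :=
  .seq (.value 3 (.const 0) 2)
    (.ite
      (.realLt
        (.div (.mul (.mul (scalar 0) (scalar 0)) (scalar 7)) (.const 72)) (scalar 3))
      (.setNat 2 (counter 4) (.const 0)) .skip)

/-- Remove agents one by one until the value is at most `a² Y / 72`. -/
def shrinkProgram : Program := forLoop 4 shrinkBody

def halveBody : Program :=
  .setReal 2 (counter 4) (.div (.get 2 (counter 4)) (.const 2))

def priceBody : Program :=
  .ite (.realLt (.get 5 (counter 5)) (.get 5 (counter 4)))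
    (.setReal 2 (counter 4) (.add (.get 5 (counter 4)) (.const 1)))
    (.setReal 2 (counter 4)
      (.mul (.div (scalar 0) (.const 3)) (.sqrt (.mul (.get 1 (counter 4)) (scalar 7)))))

def shareBody : Program :=
  .ite memTest
    (.seq removeProgram (.seq insertProgram
      (.setReal 4 (.const 0)
        (.add (scalar 4) (.div (.get 1 (counter 4)) marginalExpr)))))
    .skip

/-- Compute the share of the current team. -/
def shareProgram : Program :=
  .seq (.setReal 4 (.const 0) (.const 0)) (forLoop 4 shareBody)

/-- The utility of the current team, once its share and its value have been computed. -/
def utilityExpr : RExpr := .mul (.sub (.const 1) (scalar 4)) (scalar 3)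

def copyBody : Program := .setNat 1 (counter 4) (.get 2 (counter 4))

/-- Replace the best team by the current team if the latter has a larger utility. -/
def considerProgram : Program :=
  .seq shareProgram
    (.seq (.value 3 (.const 0) 2)
      (.ite (.realLt (scalar 6) utilityExpr)
        (.seq (.setReal 6 (.const 0) utilityExpr) (forLoop 4 copyBody))
        .skip))

/-- Consider the team that consists of the agent given by counter `5`. -/
def singleProgram : Program :=
  .seq (.seq (.setNat 2 (counter 5) (.const 1)) (.value 5 (counter 5) 2))
    (.seq considerProgram (.setNat 2 (counter 5) (.const 0)))

/-- Compute and consider a team for the next guess. -/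
def guessProgram : Program :=
  .seq (.setReal 7 (.const 0) (.add (scalar 7) (.get 5 (counter 5))))
    (.seq (forLoop 4 priceBody) (.seq (.demand 2 2) (.seq cleanProgram
      (.seq shrinkProgram (.seq (forLoop 4 halveBody) (.seq cleanProgram considerProgram))))))

/-- The guesses `k f {j}` arise by repeated addition, as the counter cannot be converted to a real
number. -/
def guessesProgram : Program :=
  .seq (.setReal 7 (.const 0) (.const 0)) (forLoop 6 guessProgram)

/-- The approximation algorithm. -/
def contractProgram : Program :=
  .seq (forLoop 5 singleProgram) (forLoop 5 guessesProgram)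

end Programs

/-! ### Specifications of the subroutines. -/

section Specs

variable {n : ℕ} {f : Finset (Fin n) → ℝ} {dem : (Fin n → ℝ) → Finset (Fin n)}

theorem memTest_holds {σ : State} {i : Fin n} (hi : σ.nat 4 0 = i) :
    memTest.holds σ ↔ i ∈ σ.readSet n 2 := by
  simp [memTest, BExpr.holds, NExpr.eval, State.mem_readSet, hi, Nat.pos_iff_ne_zero]

theorem removeProgram_run {σ : State} {i : Fin n} (hi : σ.nat 4 0 = i) :
    (removeProgram.run f dem σ).readSet n 2 = (σ.readSet n 2).erase i ∧
    marginalExpr.eval (removeProgram.run f dem σ) =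
      f (σ.readSet n 2) - f ((σ.readSet n 2).erase i) := by
  simp [removeProgram, marginalExpr, Program.run, RExpr.eval, NExpr.eval, hi]

theorem removeProgram_frame {σ : State} :
    Frame removeProgram σ (removeProgram.run f dem σ) := by
  obtain ⟨t, τ, he, -, rfl⟩ := Program.LoopFree.exec (P := removeProgram) (val := f) (dem := dem)
    (by simp [removeProgram, Program.LoopFree]) σ
  exact he.frame

theorem cleanBody_loopFree : cleanBody.LoopFree := by
  simp [cleanBody, removeProgram, insertProgram, incrProgram, Program.LoopFree]

/-- The running time of `cleanProgram`. -/
noncomputable def cleanTime : Polynomial ℕ :=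
  .C 3 + (.X * (.X + 1) + .X + 1) *
    (.C ((BExpr.natLt (counter 4) (counter 0)).cost + 1) + cleanBody.time)

theorem marginal_of_mem {S : Finset (Fin n)} {i : Fin n} (hi : i ∈ S) :
    marginal f i S = f S - f (S.erase i) := by
  rw [marginal, Finset.insert_eq_of_mem hi]

/-- The effect of one step of `cleanProgram` at agent `i`. -/
theorem cleanBody_run {σ : State} {i : Fin n} (hi : σ.nat 4 0 = i) :
    (σ.readVec n 2 i ≤ marginal f i (σ.readSet n 2) ∨ i ∉ σ.readSet n 2) ∧
        (cleanBody.run f dem σ).readSet n 2 = σ.readSet n 2 ∧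
        (cleanBody.run f dem σ).nat 4 0 = i + 1 ∨
      i ∈ σ.readSet n 2 ∧ marginal f i (σ.readSet n 2) < σ.readVec n 2 i ∧
        (cleanBody.run f dem σ).readSet n 2 = (σ.readSet n 2).erase i ∧
        (cleanBody.run f dem σ).nat 4 0 = 0 := by
  by_cases hm : i ∈ σ.readSet n 2
  · obtain ⟨hr, hx⟩ := removeProgram_run (f := f) (dem := dem) hi
    have hf := removeProgram_frame (f := f) (dem := dem) (σ := σ)
    have h4 : (removeProgram.run f dem σ).nat 4 0 = i := by
      rw [hf.nat 4 (by simp [removeProgram, Program.WritesNat]), hi]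
    have h2 : (removeProgram.run f dem σ).real 2 i = σ.readVec n 2 i := by
      rw [hf.real 2 (by simp [removeProgram, Program.WritesReal])]; rfl
    rw [marginal_of_mem hm]
    by_cases hlt : f (σ.readSet n 2) - f ((σ.readSet n 2).erase i) < σ.readVec n 2 i
    · right
      simp only [cleanBody, Program.run, (memTest_holds hi).2 hm, if_true, BExpr.holds, hx,
        RExpr.eval, NExpr.eval, h4, h2, hlt, true_and]
      simp [hr, hm]
    · left
      simp only [cleanBody, Program.run, (memTest_holds hi).2 hm, if_true, BExpr.holds, hx,
        RExpr.eval, NExpr.eval, h4, h2, hlt, if_false, insertProgram, incrProgram]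
      simp [hr, hm, h4, not_lt.1 hlt]
  · left
    simp [cleanBody, Program.run, memTest_holds hi, hm, incrProgram, NExpr.eval, hi]

/-- Removing an agent whose marginal contribution is below its price saves more than it loses, so
value minus price does not decrease. At the end the scan has passed every agent since the last
removal. -/
theorem cleanProgram_runs {σ : State} (hn : σ.nat 0 0 = n) :
    Runs f dem cleanProgram σ cleanTime fun τ =>
      τ.readSet n 2 ⊆ σ.readSet n 2 ∧
      (∀ i ∈ τ.readSet n 2, σ.readVec n 2 i ≤ marginal f i (τ.readSet n 2)) ∧
      f (σ.readSet n 2) - ∑ i ∈ σ.readSet n 2, σ.readVec n 2 i ≤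
        f (τ.readSet n 2) - ∑ i ∈ τ.readSet n 2, σ.readVec n 2 i := by
  have hstart : Program.LoopFree (.setNat 4 (.const 0) (.const 0)) := by simp [Program.LoopFree]
  unfold cleanTime cleanProgram
  refine Runs.seq (B₁ := .C 3) (Q₁ := fun τ => τ.nat 4 0 = 0 ∧ τ.readSet n 2 = σ.readSet n 2)
    (by simpa [Program.time, NExpr.cost] using hstart.runs (by simp [Program.run, NExpr.eval]))
    fun τ hτ hτ' => ?_
  have hq : τ.readVec n 2 = σ.readVec n 2 :=
    State.readVec_congr (hτ.real 2 (by simp [Program.WritesReal])) n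
  have hn' : τ.nat 0 0 = n := by rw [hτ.nat 0 (by simp [Program.WritesNat]), hn]
  have hloop := Runs.loop (val := f) (dem := dem) (n := n) (σ := τ) (N := .X * (.X + 1) + .X)
    (P := cleanBody) (t := .natLt (counter 4) (counter 0))
    (I := fun ρ => ρ.nat 0 0 = n ∧ ρ.nat 4 0 ≤ n ∧ ρ.readVec n 2 = σ.readVec n 2 ∧
      ρ.readSet n 2 ⊆ σ.readSet n 2 ∧
      (∀ i ∈ ρ.readSet n 2, i.val < ρ.nat 4 0 → σ.readVec n 2 i ≤ marginal f i (ρ.readSet n 2)) ∧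
      f (σ.readSet n 2) - ∑ i ∈ σ.readSet n 2, σ.readVec n 2 i ≤
        f (ρ.readSet n 2) - ∑ i ∈ ρ.readSet n 2, σ.readVec n 2 i)
    -- Lexicographic measure: the weight `n + 1` of a member outweighs the reset of the counter,
    -- which gives back at most `n`.
    (μ := fun ρ => (ρ.readSet n 2).card * (n + 1) + (n - ρ.nat 4 0))
    (B := cleanBody.time) ?_ ?_ ?_
  · refine hloop.imp ?_
    rintro ρ - ⟨⟨h0, hle, -, hsub, hmarg, hval⟩, hnot⟩
    simp only [BExpr.holds, NExpr.eval, h0] at hnot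
    exact ⟨hsub, fun i hi => hmarg i hi (by omega), hval⟩
  · simp [hτ', hq, hn']
  · have := Finset.card_le_univ (τ.readSet n 2)
    rw [Fintype.card_fin] at this
    simp only [Polynomial.eval_add, Polynomial.eval_mul, Polynomial.eval_X, Polynomial.eval_one]
    exact add_le_add (Nat.mul_le_mul_right _ this) (by omega)
  · rintro ρ ⟨h0, -, hρq, hsub, hmarg, hval⟩ hlt
    simp only [BExpr.holds, NExpr.eval, h0] at hlt
    refine (cleanBody_loopFree.exec ρ).imp fun ρ' hf hρ' => ?_
    have h0' : ρ'.nat 0 0 = n := by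
      rw [hf.nat 0 (by
        simp [cleanBody, removeProgram, insertProgram, incrProgram, Program.WritesNat]), h0]
    have hq' : ρ'.readVec n 2 = σ.readVec n 2 := by
      rw [← hρq]
      exact State.readVec_congr (hf.real 2 (by
        simp [cleanBody, removeProgram, insertProgram, incrProgram, Program.WritesReal])) n
    rcases cleanBody_run (f := f) (dem := dem) (i := ⟨_, hlt⟩) (σ := ρ) rfl with
      ⟨hor, hset, hidx⟩ | ⟨hmem, hless, hset, hidx⟩
    · rw [← hρ'] at hset hidx
      simp only [h0', hq', hset, hidx]
      refine ⟨⟨trivial, hlt, trivial, hsub, fun i hi hi' => ?_, hval⟩, by omega⟩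
      rcases Nat.lt_succ_iff_lt_or_eq.1 hi' with h | h
      · exact hmarg i hi h
      · obtain rfl : i = ⟨_, hlt⟩ := Fin.ext h
        rw [← hρq]
        exact hor.resolve_right (not_not.2 hi)
    · rw [← hρ'] at hset hidx
      rw [marginal_of_mem hmem, hρq] at hless
      simp only [h0', hq', hset, hidx]
      refine ⟨⟨trivial, Nat.zero_le _, trivial, (Finset.erase_subset _ _).trans hsub,
        fun i _ hi' => absurd hi' (Nat.not_lt_zero _), ?_⟩, ?_⟩
      · have := Finset.add_sum_erase _ (σ.readVec n 2) hmem
        linarith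
      · have := Finset.card_erase_add_one hmem
        rw [← this]
        simp only [add_mul]
        omega

/-- An agent is removed only while the value exceeds `M`, and by subadditivity this loses at most
`m`, so the value never falls below `M - m` through a removal. If it always stayed above `M`, all
agents would be removed, which contradicts `f ∅ = 0 ≤ M`. -/
theorem shrinkProgram_runs {σ : State} (hn : σ.nat 0 0 = n) (hempty : f ∅ = 0)
    (hsub : ∀ S i, f S ≤ f (S.erase i) + f {i}) {M m : ℝ}
    (hM : σ.real 0 0 * σ.real 0 0 * σ.real 7 0 / 72 = M) (hM0 : 0 ≤ M)
    (hm : ∀ i ∈ σ.readSet n 2, f {i} ≤ m) :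
    Runs f dem shrinkProgram σ (forTime shrinkBody.time) fun τ =>
      τ.readSet n 2 ⊆ σ.readSet n 2 ∧ f (τ.readSet n 2) ≤ M ∧
        (τ.readSet n 2 = σ.readSet n 2 ∨ M - m ≤ f (τ.readSet n 2)) := by
  refine (Runs.forLoop (I := fun i τ => τ.readSet n 2 ⊆ σ.readSet n 2 ∧
      (f (τ.readSet n 2) ≤ M ∨ ∀ x ∈ τ.readSet n 2, i ≤ x.val) ∧
        (τ.readSet n 2 = σ.readSet n 2 ∨ M - m ≤ f (τ.readSet n 2))) (by norm_num)
      (by simp [shrinkBody, Program.WritesNat]) (by simp [shrinkBody, Program.WritesNat]) hn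
      (by simp) (by simp) ?_).imp ?_
  · intro i τ hi hf ⟨hss, hor, hlow⟩
    refine Program.LoopFree.runs (by simp [shrinkBody, Program.LoopFree]) ?_
    have h0 : τ.real 0 = σ.real 0 := hf.real 0 (by simp [shrinkBody, Program.WritesReal])
    have h7 : τ.real 7 = σ.real 7 := hf.real 7 (by simp [shrinkBody, Program.WritesReal])
    by_cases hlt : M < f (τ.readSet n 2)
    · have hset : (shrinkBody.run f dem τ).readSet n 2 = (τ.readSet n 2).erase i := by
        simp [shrinkBody, Program.run, BExpr.holds, RExpr.eval, NExpr.eval, h0, h7, hM, hlt, hi]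
      rw [hset]
      refine ⟨(Finset.erase_subset _ _).trans hss, .inr fun x hx => ?_, ?_⟩
      · have := hor.resolve_left (not_le.2 hlt) x (Finset.mem_of_mem_erase hx)
        have hne : x.val ≠ i.val := fun h => Finset.ne_of_mem_erase hx (Fin.ext h)
        omega
      · by_cases him : i ∈ τ.readSet n 2
        · right
          have h1 := hsub (τ.readSet n 2) i
          have h2 := hm i (hss him)
          linarith
        · rwa [Finset.erase_eq_of_notMem him]
    · have hset : (shrinkBody.run f dem τ).readSet n 2 = τ.readSet n 2 := by
        simp [shrinkBody, Program.run, BExpr.holds, RExpr.eval, NExpr.eval, h0, h7, hM, hlt]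
      rw [hset]
      exact ⟨hss, .inl (not_lt.1 hlt), hlow⟩
  · rintro τ - ⟨hss, hor, hlow⟩
    refine ⟨hss, hor.elim id fun h => ?_, hlow⟩
    have : τ.readSet n 2 = ∅ :=
      Finset.eq_empty_of_forall_notMem fun x hx => absurd (h x hx) (not_le.2 x.isLt)
    rwa [this, hempty]

/-- A loop that overwrites the price vector. -/
theorem Runs.fillPrices {P : Program} {σ : State} (hP : P.LoopFree) (hn : σ.nat 0 0 = n)
    (hnat : ∀ l, ¬ P.WritesNat l) (hreal : ∀ l, P.WritesReal l → l = 2) {w : Fin n → ℝ}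
    (h : ∀ (i : Fin n) τ, τ.nat 4 0 = i.val → (∀ l, l ≠ 4 → τ.nat l = σ.nat l) →
      (∀ l, l ≠ 2 → τ.real l = σ.real l) → τ.real 2 i = σ.real 2 i →
      P.run f dem τ = τ.writeReal 2 i (w i)) :
    Runs f dem (ContractDesign.forLoop 4 P) σ (forTime P.time) fun τ => τ.readVec n 2 = w := by
  refine (Runs.forLoop (I := fun i τ => ∀ x : Fin n, τ.real 2 x =
      if x.val < i then w x else σ.real 2 x) (by norm_num) (hnat 0) (hnat 4) hn (by simp)
      (by simp) ?_).imp ?_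
  · intro i τ hi hf hI
    refine hP.runs ?_
    rw [h i τ hi (fun l hl => hf.nat l (by simp [hl, hnat l]))
      (fun l hl => hf.real l (by rw [forLoop_writesReal]; exact mt (hreal l) hl)) (by simp [hI i])]
    intro x
    rcases lt_trichotomy x.val i.val with hx | hx | hx
    · simp [hI x, hx.ne, hx, Nat.lt_succ_of_lt hx]
    · obtain rfl := Fin.ext hx
      simp
    · have h1 : ¬ x.val < i.val + 1 := by omega
      simp [hI x, hx.ne', h1, hx.not_gt]
  · intro τ _ hI
    funext x
    simp [State.readVec, hI x]

theorem halve_runs {σ : State} (hn : σ.nat 0 0 = n) :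
    Runs f dem (forLoop 4 halveBody) σ (forTime halveBody.time)
      fun τ => τ.readVec n 2 = fun i => σ.readVec n 2 i / 2 := by
  refine .fillPrices (by simp [halveBody, Program.LoopFree]) hn
    (by simp [halveBody, Program.WritesNat]) (by simp [halveBody, Program.WritesReal]) ?_
  intro i τ hi _ _ h2
  simp [halveBody, Program.run, RExpr.eval, NExpr.eval, hi, h2, State.readVec]

/-- The state contains the input. -/
structure HasInput (a : ℝ) (c : Fin n → ℝ) (σ : State) : Prop where
  size : σ.nat 0 0 = n
  quality : σ.real 0 0 = a
  costs : ∀ i : Fin n, σ.real 1 i = c i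

theorem HasInput.frame {a : ℝ} {c : Fin n → ℝ} {σ τ : State} {P : Program} (h : HasInput a c σ)
    (hf : Frame P σ τ) (h0 : ¬ P.WritesNat 0) (h0' : ¬ P.WritesReal 0) (h1 : ¬ P.WritesReal 1) :
    HasInput a c τ := by
  constructor
  · rw [hf.nat 0 h0, h.size]
  · rw [hf.real 0 h0', h.quality]
  · intro i
    rw [hf.real 1 h1, h.costs]

/-- The prices for the guess `Y`, which exclude agents with a larger value than agent `j`. -/
noncomputable def price (f : Finset (Fin n) → ℝ) (c : Fin n → ℝ) (a : ℝ) (j : Fin n) (Y : ℝ)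
    (i : Fin n) : ℝ :=
  if f {j} < f {i} then f {i} + 1 else a / 3 * √(c i * Y)

theorem price_runs {σ : State} {a Y : ℝ} {c : Fin n → ℝ} {j : Fin n} (hin : HasInput a c σ)
    (hj : σ.nat 5 0 = j) (hf : ∀ i : Fin n, σ.real 5 i = f {i}) (hY : σ.real 7 0 = Y) :
    Runs f dem (forLoop 4 priceBody) σ (forTime priceBody.time)
      fun τ => τ.readVec n 2 = price f c a j Y := by
  refine .fillPrices (by simp [priceBody, Program.LoopFree]) hin.size
    (by simp [priceBody, Program.WritesNat]) (by simp [priceBody, Program.WritesReal]) ?_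
  intro i τ hi hnat hreal _
  simp only [priceBody, Program.run, RExpr.eval, NExpr.eval, BExpr.holds, hi, hnat 5 (by norm_num),
    hreal 0 (by norm_num), hreal 1 (by norm_num), hreal 5 (by norm_num), hreal 7 (by norm_num),
    hj, hf, hY, hin.quality, hin.costs, price]
  split_ifs <;> simp

theorem shareProgram_runs {σ : State} {a : ℝ} {c : Fin n → ℝ} (hin : HasInput a c σ) :
    Runs f dem shareProgram σ (.C 3 + forTime shareBody.time) fun τ =>
      τ.readSet n 2 = σ.readSet n 2 ∧ τ.real 4 0 = share f c (σ.readSet n 2) := by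
  have hstart : Program.LoopFree (.setReal 4 (.const 0) (.const 0)) := by simp [Program.LoopFree]
  refine Runs.seq (Q₁ := fun τ => τ.real 4 0 = 0)
    (by simpa [Program.time, NExpr.cost, RExpr.cost] using
      hstart.runs (by simp [Program.run, NExpr.eval, RExpr.eval])) fun τ hτ hτ' => ?_
  have hset : τ.readSet n 2 = σ.readSet n 2 :=
    State.readSet_congr (hτ.nat 2 (by simp [Program.WritesNat])) n
  have hin' : HasInput a c τ := hin.frame hτ (by simp [Program.WritesNat])
    (by simp [Program.WritesReal]) (by simp [Program.WritesReal])
  refine (Runs.forLoop (I := fun i ρ => ρ.readSet n 2 = σ.readSet n 2 ∧ ρ.real 4 0 =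
      ∑ x ∈ σ.readSet n 2 with x.val < i, c x / marginal f x (σ.readSet n 2)) (by norm_num)
      (by simp [shareBody, removeProgram, insertProgram, Program.WritesNat])
      (by simp [shareBody, removeProgram, insertProgram, Program.WritesNat]) hin'.size
      (by simp) (by simp [hset, hτ']) ?_).imp ?_
  · intro i ρ hi hf ⟨hρ, hsum⟩
    refine Program.LoopFree.runs
      (by simp [shareBody, removeProgram, insertProgram, Program.LoopFree]) ?_
    have hfilter : (σ.readSet n 2).filter (fun x => x.val < i.val + 1) =
        if i ∈ σ.readSet n 2 then insert i ((σ.readSet n 2).filter fun x => x.val < i.val)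
        else (σ.readSet n 2).filter fun x => x.val < i.val := by
      split_ifs with him <;> ext x <;>
        simp only [Finset.mem_filter, Finset.mem_insert, Nat.lt_succ_iff_lt_or_eq, Fin.val_inj]
      · constructor
        · tauto
        · rintro (rfl | h) <;> tauto
      · constructor
        · rintro ⟨h, h' | rfl⟩ <;> tauto
        · tauto
    rw [hfilter]
    by_cases him : i ∈ σ.readSet n 2
    · obtain ⟨hr, hx⟩ := removeProgram_run (f := f) (dem := dem) hi
      have hfr := removeProgram_frame (f := f) (dem := dem) (σ := ρ)
      have h4 : (removeProgram.run f dem ρ).nat 4 0 = i := by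
        rw [hfr.nat 4 (by simp [removeProgram, Program.WritesNat]), hi]
      have h4' : (removeProgram.run f dem ρ).real 4 0 = ρ.real 4 0 := by
        rw [hfr.real 4 (by simp [removeProgram, Program.WritesReal])]
      have h1 : (removeProgram.run f dem ρ).real 1 i = c i := by
        rw [hfr.real 1 (by simp [removeProgram, Program.WritesReal]), hf.real 1
          (by simp [shareBody, removeProgram, insertProgram, Program.WritesReal]), hin'.costs]
      have hmark : ∀ v, marginalExpr.eval ((removeProgram.run f dem ρ).writeNat 2 i v) =
          marginalExpr.eval (removeProgram.run f dem ρ) := fun v => rfl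
      rw [if_pos him, Finset.sum_insert (by simp), marginal_of_mem him, ← hρ, ← hx, hρ]
      simp only [shareBody, Program.run, (memTest_holds hi).2 (hρ ▸ him), if_true, insertProgram,
        RExpr.eval, NExpr.eval, h4, hmark]
      simp [hr, hρ, him, h4, h4', h1, hsum, add_comm]
    · rw [if_neg him]
      simpa [shareBody, Program.run, memTest_holds hi, hρ, him] using hsum
  · rintro ρ - ⟨hρ, hsum⟩
    exact ⟨hρ, by simpa [share] using hsum⟩

theorem copy_runs {σ : State} (hn : σ.nat 0 0 = n) :
    Runs f dem (forLoop 4 copyBody) σ (forTime copyBody.time) fun τ =>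
      τ.readSet n 1 = σ.readSet n 2 := by
  refine (Runs.forLoop (I := fun i τ => ∀ x : Fin n, x.val < i → τ.nat 1 x = σ.nat 2 x)
      (by norm_num) (by simp [copyBody, Program.WritesNat]) (by simp [copyBody, Program.WritesNat])
      hn (by simp) (by simp) ?_).imp ?_
  · intro i τ hi hf hI
    refine Program.LoopFree.runs (by simp [copyBody, Program.LoopFree]) fun x hx => ?_
    have h2 : τ.nat 2 = σ.nat 2 := hf.nat 2 (by simp [copyBody, Program.WritesNat])
    rcases Nat.lt_succ_iff_lt_or_eq.1 hx with h | h
    · simp [copyBody, Program.run, NExpr.eval, hi, h.ne, hI x h]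
    · simp [copyBody, Program.run, NExpr.eval, hi, h, h2]
  · intro τ _ hI
    ext x
    rw [State.mem_readSet, State.mem_readSet, hI x x.isLt]

/-- The best team so far is feasible, and its stored utility is at least `x`. -/
structure HasBest (f : Finset (Fin n) → ℝ) (c : Fin n → ℝ) (x : ℝ) (σ : State) : Prop where
  feasible : BFeasible f c 1 (σ.readSet n 1)
  utility_eq : utility f c (σ.readSet n 1) = σ.real 6 0
  nonneg : 0 ≤ σ.real 6 0
  le : x ≤ σ.real 6 0

theorem HasBest.frame {c : Fin n → ℝ} {x : ℝ} {σ τ : State} {P : Program} (h : HasBest f c x σ)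
    (hf : Frame P σ τ) (h1 : ¬ P.WritesNat 1) (h6 : ¬ P.WritesReal 6) : HasBest f c x τ := by
  have h1' := State.readSet_congr (hf.nat 1 h1) n
  have h6' := hf.real 6 h6
  constructor
  · rw [h1']; exact h.feasible
  · rw [h1', h6']; exact h.utility_eq
  · rw [h6']; exact h.nonneg
  · rw [h6']; exact h.le

/-- The running time of `considerProgram`. -/
noncomputable def considerTime : Polynomial ℕ :=
  (.C 3 + forTime shareBody.time) + (.C 1 + .X + 1 +
    (.C 11 + ((.C 9 + forTime copyBody.time) + 1)))

/-- Feasibility needs no test: a team is adopted only if its utility exceeds a nonnegative number,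
and `(1 - ρ) f > 0` with `f ≥ 0` forces `ρ < 1`. -/
theorem considerProgram_runs {σ : State} {a x : ℝ} {c : Fin n → ℝ} (hin : HasInput a c σ)
    (hbest : HasBest f c x σ) (hinc : Incentivizable f (σ.readSet n 2))
    (hf0 : ∀ S, 0 ≤ f S) :
    Runs f dem considerProgram σ considerTime fun τ => τ.readSet n 2 = σ.readSet n 2 ∧
      HasBest f c x τ ∧ utility f c (σ.readSet n 2) ≤ τ.real 6 0 := by
  refine Runs.seq (shareProgram_runs hin) fun τ₁ hτ₁ ⟨hset₁, hshare⟩ => ?_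
  have hw : ¬ shareProgram.WritesNat 1 ∧ ¬ shareProgram.WritesReal 6 ∧
      ¬ shareProgram.WritesNat 0 ∧ ¬ shareProgram.WritesReal 0 ∧ ¬ shareProgram.WritesReal 1 := by
    simp [shareProgram, shareBody, removeProgram, insertProgram, Program.WritesNat,
      Program.WritesReal]
  have hbest₁ := hbest.frame hτ₁ hw.1 hw.2.1
  have hin₁ := hin.frame hτ₁ hw.2.2.1 hw.2.2.2.1 hw.2.2.2.2
  refine Runs.seq (Q₁ := fun τ => τ = τ₁.writeReal 3 0 (f (σ.readSet n 2)))
    (by simpa [Program.time, NExpr.cost] using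
      Program.LoopFree.runs (P := .value 3 (.const 0) 2) (by simp [Program.LoopFree])
          (by simp [Program.run, NExpr.eval, hset₁])) fun τ₂ hτ₂ hτ₂' => ?_
  have hbest₂ := hbest₁.frame hτ₂ (by simp [Program.WritesNat]) (by simp [Program.WritesReal])
  have hin₂ := hin₁.frame hτ₂ (by simp [Program.WritesNat]) (by simp [Program.WritesReal])
    (by simp [Program.WritesReal])
  have hset₂ : τ₂.readSet n 2 = σ.readSet n 2 := by rw [hτ₂']; simp [hset₁]
  have hut : utilityExpr.eval τ₂ = utility f c (σ.readSet n 2) := by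
    simp [utilityExpr, RExpr.eval, NExpr.eval, hτ₂', hshare, utility]
  refine Runs.ite (fun ht => ?_) fun ht => ?_
  · simp only [BExpr.holds, RExpr.eval, NExpr.eval, hut] at ht
    refine Runs.seq (Q₁ := fun τ => τ.real 6 0 = utility f c (σ.readSet n 2))
      (by simpa [Program.time, NExpr.cost, RExpr.cost, utilityExpr] using
        Program.LoopFree.runs (P := .setReal 6 (.const 0) utilityExpr) (by simp [Program.LoopFree])
            (by simp [Program.run, NExpr.eval, hut])) fun τ₃ hτ₃ hτ₃' => ?_
    have hset₃ : τ₃.readSet n 2 = σ.readSet n 2 := by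
      rw [← hset₂]
      exact State.readSet_congr (hτ₃.nat 2 (by simp [Program.WritesNat])) n
    refine (copy_runs (by rw [hτ₃.nat 0 (by simp [Program.WritesNat]), hin₂.size])).imp
      fun τ hτ hcopy => ?_
    have h6 : τ.real 6 0 = utility f c (σ.readSet n 2) := by
      rw [hτ.real 6 (by simp [copyBody, Program.WritesReal]), hτ₃']
    rw [hset₃] at hcopy
    have hpos : 0 < utility f c (σ.readSet n 2) := hbest₂.nonneg.trans_lt ht
    refine ⟨?_, ⟨?_, ?_, ?_, ?_⟩, h6.ge⟩
    · rw [← hset₃]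
      exact State.readSet_congr (hτ.nat 2 (by simp [copyBody, Program.WritesNat])) n
    · rw [hcopy]
      exact ⟨hinc, by linarith [pos_of_mul_pos_left hpos (hf0 _)]⟩
    · rw [hcopy, h6]
    · rw [h6]; exact hpos.le
    · rw [h6]; exact hbest₂.le.trans ht.le
  · simp only [BExpr.holds, RExpr.eval, NExpr.eval, hut, not_lt] at ht
    exact ⟨_, _, .skip _, by simp, hset₂, hbest₂, ht⟩

end Specs

/-! ## Analysis of the algorithm -/

section Analysis

variable {n : ℕ} {f : Finset (Fin n) → ℝ} {c : Fin n → ℝ}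

theorem IsSetting.nonneg (hs : IsSetting f c) (S : Finset (Fin n)) : 0 ≤ f S :=
  hs.empty ▸ hs.mono ∅ S (Finset.empty_subset S)

/-- Every set has a supporting additive function. -/
theorem IsXOS.exists_support (hf : IsXOS f) (h0 : f ∅ = 0) (S : Finset (Fin n)) :
    ∃ x : Fin n → ℝ, f S = ∑ i ∈ S, x i ∧ ∀ T, ∑ i ∈ T, x i ≤ f T := by
  obtain ⟨k, h, hadd, hmax⟩ := hf
  obtain ⟨l, hl⟩ := (hmax S).1
  -- `IsAdditive` by itself allows a positive value at the empty set; here `f ∅ = 0` excludes it.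
  have hempty : h l ∅ = 0 :=
    le_antisymm (h0 ▸ (hmax ∅).2 ⟨l, rfl⟩) ((hadd l).1 ∅)
  have hsum : ∀ T, h l T = ∑ i ∈ T, h l {i} := by
    intro T
    induction T using Finset.induction_on with
    | empty => simp [hempty]
    | insert i T hi ih => rw [(hadd l).2 T i hi, ih, Finset.sum_insert hi, add_comm]
  exact ⟨fun i => h l {i}, by rw [← hsum]; exact hl.symm,
    fun T => by rw [← hsum]; exact (hmax T).2 ⟨l, rfl⟩⟩

/-- An additive function supporting `S` attributes at most `f {i}` to `i`, and bounds `f` from below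
on the rest. -/
theorem IsSetting.le_erase_add (hs : IsSetting f c) (hf : IsXOS f) (S : Finset (Fin n))
    (i : Fin n) : f S ≤ f (S.erase i) + f {i} := by
  by_cases hi : i ∈ S
  · obtain ⟨x, hS, hx⟩ := hf.exists_support hs.empty S
    rw [hS, ← Finset.sum_erase_add _ _ hi]
    exact add_le_add (hx _) (by simpa using hx {i})
  · rw [Finset.erase_eq_of_notMem hi]
    linarith [hs.nonneg {i}]

theorem IsSetting.le_sum_singletons (hs : IsSetting f c) (hf : IsXOS f) (S : Finset (Fin n)) :
    f S ≤ ∑ i ∈ S, f {i} := by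
  obtain ⟨x, hS, hx⟩ := hf.exists_support hs.empty S
  rw [hS]
  exact Finset.sum_le_sum fun i _ => by simpa using hx {i}

/-- The additive function is exact at `S` and only a lower bound at `S.erase i`, so it overestimates
the difference. -/
theorem marginal_le_support {S : Finset (Fin n)} {x : Fin n → ℝ} (hS : f S = ∑ i ∈ S, x i)
    (hx : ∀ T, ∑ i ∈ T, x i ≤ f T) {i : Fin n} (hi : i ∈ S) : marginal f i S ≤ x i := by
  have := Finset.sum_erase_add _ x hi
  rw [marginal_of_mem hi, hS]
  linarith [hx (S.erase i)]

/-- If the marginal contributions to `S` are at least the prices, then every subset of `S` is worth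
its price. -/
theorem IsSetting.sum_price_le (hs : IsSetting f c) (hf : IsXOS f) {S T : Finset (Fin n)}
    (hTS : T ⊆ S) {q : Fin n → ℝ} (hq : ∀ i ∈ S, q i ≤ marginal f i S) : ∑ i ∈ T, q i ≤ f T := by
  obtain ⟨x, hS, hx⟩ := hf.exists_support hs.empty S
  exact (Finset.sum_le_sum fun i hi =>
    (hq i (hTS hi)).trans (marginal_le_support hS hx (hTS hi))).trans (hx T)

theorem IsSetting.utility_singleton (hs : IsSetting f c) (i : Fin n) :
    Incentivizable f {i} ∧ utility f c {i} = f {i} - c i := by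
  have hm : marginal f i {i} = f {i} := by simp [marginal, hs.empty]
  refine ⟨fun j hj => ?_, ?_⟩
  · obtain rfl := Finset.mem_singleton.1 hj
    rw [hm]
    exact hs.value_pos j
  · have := (hs.value_pos i).ne'
    simp only [utility, share, Finset.sum_singleton, hm]
    field_simp

/-- The utility `g` is large compared with the value of any team `S` for which `j` is a most
valuable possible member and the guess `Y` is correct. -/
def GuessGood (f : Finset (Fin n) → ℝ) (c : Fin n → ℝ) (a : ℝ) (j : Fin n) (Y g : ℝ) : Prop :=
  ∀ S, (∀ i ∈ S, f {i} ≤ f {j}) → (∑ i ∈ S, √(c i)) ^ 2 ≤ 2 * f S → Y ≤ f S → f S ≤ 2 * Y →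
    288 * f {j} ≤ a ^ 2 * f S → a ^ 2 * f S ≤ 768 * g

theorem GuessGood.mono {a Y g g' : ℝ} {j : Fin n} (h : GuessGood f c a j Y g) (hg : g ≤ g') :
    GuessGood f c a j Y g' :=
  fun S h₁ h₂ h₃ h₄ h₅ => (h S h₁ h₂ h₃ h₄ h₅).trans (by linarith)

theorem IsSetting.price_pos (hs : IsSetting f c) {a Y : ℝ} (ha : 0 < a) (hY : 0 < Y)
    (j i : Fin n) : 0 < price f c a j Y i := by
  have h₁ := hs.value_pos i
  have h₂ := hs.cost_pos i
  rw [price]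
  split_ifs <;> positivity

/-- By subadditivity no marginal contribution of `i` reaches the excluding price `f {i} + 1`. -/
theorem IsSetting.value_le_of_price_le (hs : IsSetting f c) (hf : IsXOS f) {a Y : ℝ} {j i : Fin n}
    {S : Finset (Fin n)} (hi : i ∈ S) (h : price f c a j Y i ≤ marginal f i S) :
    f {i} ≤ f {j} := by
  by_contra! hlt
  rw [price, if_pos hlt, marginal_of_mem hi] at h
  linarith [hs.le_erase_add hf S i]

/-- The sets are `D` from the oracle, `D'` after cleaning, `T` after shrinking and `U` after
cleaning at half prices. The value of `U` is kept between `M / 4` and `M`: the lower bound makes the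
utility large, the upper bound makes the share small. -/
theorem GuessGood.of_steps (hs : IsSetting f c) (hf : IsXOS f) {a Y M : ℝ} (ha : 0 < a)
    (ha1 : a ≤ 1) (hY : 0 < Y) (hM : a * a * Y / 72 = M) {j : Fin n}
    {D D' T U : Finset (Fin n)}
    (hD : ∀ S, a * f S - ∑ i ∈ S, price f c a j Y i ≤ f D - ∑ i ∈ D, price f c a j Y i)
    (hD' : ∀ i ∈ D', price f c a j Y i ≤ marginal f i D')
    (hDD' : f D - ∑ i ∈ D, price f c a j Y i ≤ f D' - ∑ i ∈ D', price f c a j Y i)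
    (hT : T ⊆ D') (hTM : f T ≤ M) (hTlow : T = D' ∨ M - f {j} ≤ f T)
    (hUT : U ⊆ T) (hU : ∀ i ∈ U, price f c a j Y i / 2 ≤ marginal f i U)
    (hTU : f T - ∑ i ∈ T, price f c a j Y i / 2 ≤ f U - ∑ i ∈ U, price f c a j Y i / 2) :
    GuessGood f c a j Y (utility f c U) := by
  intro S hS hSc hYS hSY hj
  set q := price f c a j Y with hq
  have hqpos : ∀ i, 0 < q i := hs.price_pos ha hY j
  have hqsum : ∀ T, 0 ≤ ∑ i ∈ T, q i := fun T => Finset.sum_nonneg fun i _ => (hqpos i).le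
  have hqval : ∀ i, f {i} ≤ f {j} → q i = a / 3 * (√Y * √(c i)) := by
    intro i hi
    rw [hq, price, if_neg (not_lt.2 hi), Real.sqrt_mul (hs.cost_pos i).le, mul_comm (√(c i))]
  have hSq : ∑ i ∈ S, q i ≤ a * f S / 2 := by
    -- Squared, the left side is at most `2 Y f S ≤ 2 (f S)²`, and `2 ≤ 9 / 4`.
    have h₁ : √Y * ∑ i ∈ S, √(c i) ≤ 3 / 2 * f S := by
      refine (abs_le_of_sq_le_sq' ?_ (by linarith)).2
      rw [mul_pow, Real.sq_sqrt hY.le]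
      nlinarith
    rw [Finset.sum_congr rfl fun i hi => hqval i (hS i hi), ← Finset.mul_sum, ← Finset.mul_sum]
    nlinarith
  have hD'low : a * f S / 2 ≤ f D' := by linarith [hD S, hqsum D']
  have haY : a * a * Y ≤ a * f S := by
    rw [mul_assoc]
    exact mul_le_mul_of_nonneg_left ((mul_le_of_le_one_left hY.le ha1).trans hYS) ha.le
  -- If nothing was removed, `f T ≥ a f S / 2 ≥ a² Y / 2 = 36 M`. Otherwise `288 f {j} ≤ a² f S ≤ 2
  -- a² Y = 144 M`, so the loss `f {j}` is at most `M / 2`.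
  have hTlow' : M / 2 ≤ f T := by
    rcases hTlow with rfl | h
    · nlinarith
    · nlinarith
  -- `T` inherits `q(T) ≤ f T` from `D'`, so its value minus half its price is at least `f T / 2`.
  have hUhalf : f T / 2 ≤ f U := by
    have h₁ := hs.sum_price_le hf hT hD'
    rw [← Finset.sum_div, ← Finset.sum_div] at hTU
    linarith [hqsum U]
  have hUM : f U ≤ M := (hs.mono _ _ hUT).trans hTM
  have hshare : share f c U ≤ 1 / 4 := by
    calc share f c U ≤ ∑ i ∈ U, q i * (18 / (a ^ 2 * Y)) := by
          refine Finset.sum_le_sum fun i hi => ?_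
          -- Members of `U` lie in `D'` and so are not priced out; the square-root price can be
          -- solved for the cost.
          have hci : c i = 9 * q i ^ 2 / (a ^ 2 * Y) := by
            rw [hqval i (hs.value_le_of_price_le hf (hT (hUT hi)) (hD' i (hT (hUT hi)))), mul_pow,
              mul_pow, Real.sq_sqrt hY.le, Real.sq_sqrt (hs.cost_pos i).le]
            field_simp
            norm_num
          calc c i / marginal f i U ≤ c i / (q i / 2) :=
                div_le_div_of_nonneg_left (hs.cost_pos i).le (half_pos (hqpos i)) (hU i hi)
            _ = q i * (18 / (a ^ 2 * Y)) := by
                have := (hqpos i).ne'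
                rw [hci]
                field_simp
                norm_num
      _ = (∑ i ∈ U, q i) * (18 / (a ^ 2 * Y)) := by rw [Finset.sum_mul]
      _ ≤ M * (18 / (a ^ 2 * Y)) := by
          have := (hs.sum_price_le hf (hUT.trans hT) hD').trans hUM
          gcongr
      _ = 1 / 4 := by
          rw [← hM]
          field_simp
          norm_num
  have h₁ : 3 / 4 * f U ≤ utility f c U :=
    mul_le_mul_of_nonneg_right (by linarith) (hs.nonneg U)
  -- The utility is at least `(3 / 4) (M / 4) = a² Y / 384`, and `f S ≤ 2 Y` doubles the constant to
  -- 768.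
  nlinarith [mul_le_mul_of_nonneg_left hSY (sq_nonneg a)]

/-- In a team that is feasible for a budget of at most `2 - η`, at most one agent requires a share of
more than `1 - η / 2`. -/
theorem BFeasible.exists_subset {b η : ℝ} {S : Finset (Fin n)} (hs : IsSetting f c)
    (hb : BFeasible f c b S) (hbη : b ≤ 2 - η) :
    ∃ S' ⊆ S, (∀ i ∈ S', c i / marginal f i S ≤ 1 - η / 2) ∧
      (S' = S ∨ ∃ e ∈ S, S' = S.erase e) := by
  by_cases h : ∃ e ∈ S, 1 - η / 2 < c e / marginal f e S
  · obtain ⟨e, he, hlt⟩ := h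
    refine ⟨S.erase e, Finset.erase_subset _ _, fun i hi => ?_, .inr ⟨e, he, rfl⟩⟩
    have h₁ := Finset.sum_erase_add _ (fun i => c i / marginal f i S) he
    -- A second agent above `1 - η / 2` would push the total share above `2 - η`.
    have h₂ := Finset.single_le_sum (f := fun i => c i / marginal f i S)
      (fun l hl => (div_pos (hs.cost_pos l) (hb.1 l (Finset.mem_of_mem_erase hl))).le) hi
    have h₃ := hb.2
    simp only [share] at h₃
    linarith
  · push Not at h
    exact ⟨S, subset_rfl, h, .inl rfl⟩

/-- The three summands of the constant pay for the exceptional agent, for a rest with a good guess,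
and for a rest whose value is dominated by one agent. -/
theorem welfare_le (hs : IsSetting f c) (hf : IsXOS f) {a b η g : ℝ} (ha : 0 < a) (hη : 0 < η)
    (hb1 : 1 ≤ b) (hb : b ≤ 2 - η) (hg : 0 ≤ g) (hsingle : ∀ i, f {i} - c i ≤ g)
    (hguess : ∀ (j : Fin n) (k : ℕ), 1 ≤ k → k ≤ n → GuessGood f c a j (k * f {j}) g)
    {S : Finset (Fin n)} (hS : BFeasible f c b S) :
    welfare f c S ≤ (1 + 768 / a ^ 2 + 864 / (η * a ^ 2)) * g := by
  obtain ⟨S', hS'S, hshare, hS'⟩ := hS.exists_subset hs hb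
  obtain ⟨x, hSx, hx⟩ := hf.exists_support hs.empty S
  have hmx : ∀ i ∈ S, marginal f i S ≤ x i := fun i hi => marginal_le_support hSx hx hi
  have hcost : ∀ T, 0 ≤ ∑ i ∈ T, c i := fun T => Finset.sum_nonneg fun i _ => (hs.cost_pos i).le
  have hx1 : ∀ i, x i ≤ f {i} := fun i => by simpa using hx {i}
  -- Splitting the supporting additive function at `e` separates `x e - c e ≤ f {e} - c e ≤ g` from
  -- the rest.
  have hW : welfare f c S ≤ g + f S' := by
    rcases hS' with rfl | ⟨e, he, rfl⟩
    · rw [welfare]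
      linarith [hcost S']
    · rw [welfare, hSx, ← Finset.sum_erase_add _ x he, ← Finset.sum_erase_add _ c he]
      linarith [hx (S.erase e), hcost (S.erase e), hx1 e, hsingle e]
  have h₁ : 0 ≤ 768 / a ^ 2 * g := by positivity
  have h₂ : 0 ≤ 864 / (η * a ^ 2) * g := by positivity
  suffices h : f S' ≤ 768 / a ^ 2 * g ∨ f S' ≤ 864 / (η * a ^ 2) * g by
    rcases h with h | h <;> linarith
  rcases S'.eq_empty_or_nonempty with rfl | hne
  · exact .inl (hs.empty.trans_le h₁)
  obtain ⟨j, hj, hjmax⟩ := S'.exists_max_image (fun i => f {i}) hne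
  have hjpos := hs.value_pos j
  -- `c j ≤ (1 - η / 2) x j ≤ (1 - η / 2) f {j}`, hence `g ≥ f {j} - c j ≥ (η / 2) f {j}`; the
  -- factor 3 leaves slack. The bounds `1 ≤ b ≤ 2 - η` give `η ≤ 1`, so `1 - η / 2` is nonnegative.
  have hfj : η * f {j} ≤ 3 * g := by
    have hm := hS.1 j (hS'S hj)
    have h₃ : c j ≤ (1 - η / 2) * x j := by
      have := (div_le_iff₀ hm).1 (hshare j hj)
      have := mul_le_mul_of_nonneg_left (hmx j (hS'S hj)) (show 0 ≤ 1 - η / 2 by linarith)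
      linarith
    nlinarith [hsingle j, hx1 j, hs.cost_pos j]
  -- In the first case `a² η f S' ≤ 288 · 3 g`, which explains 864.
  rcases lt_or_ge (a ^ 2 * f S') (288 * f {j}) with hlt | hge
  · right
    rw [div_mul_eq_mul_div, le_div_iff₀ (by positivity)]
    nlinarith
  · left
    rw [div_mul_eq_mul_div, le_div_iff₀ (by positivity), mul_comm]
    have hlow : f {j} ≤ f S' := hs.mono _ _ (Finset.singleton_subset_iff.2 hj)
    have hup : f S' ≤ n * f {j} := by
      calc f S' ≤ ∑ i ∈ S', f {i} := hs.le_sum_singletons hf S'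
        _ ≤ S'.card • f {j} := Finset.sum_le_card_nsmul _ _ _ hjmax
        _ = S'.card * f {j} := nsmul_eq_mul _ _
        _ ≤ n * f {j} := by
            have := Finset.card_le_univ S'
            rw [Fintype.card_fin] at this
            gcongr
    -- With `k` the floor of the ratio, `k ≤ f S' / f {j} < k + 1 ≤ 2 k`, so `Y = k f {j}` is a
    -- correct guess.
    have hk1 : 1 ≤ ⌊f S' / f {j}⌋₊ :=
      Nat.le_floor (by rw [Nat.cast_one]; exact (one_le_div hjpos).2 hlow)
    have hkn : ⌊f S' / f {j}⌋₊ ≤ n := Nat.floor_le_of_le ((div_le_iff₀ hjpos).2 hup)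
    refine hguess j _ hk1 hkn S' hjmax ?_ ?_ ?_ hge
    -- Cauchy–Schwarz is applied with the marginals to `S`: marginals to `S'` may be smaller, so the
    -- share of `S'` itself need not be bounded. The sum of the former is still at most `f S'`,
    -- through the support of `S`.
    · have hpos : ∀ i ∈ S', 0 < marginal f i S := fun i hi => hS.1 i (hS'S hi)
      calc (∑ i ∈ S', √(c i)) ^ 2
          ≤ (∑ i ∈ S', c i / marginal f i S) * ∑ i ∈ S', marginal f i S :=
            Finset.sum_sq_le_sum_mul_sum_of_sq_le_mul _
              (fun i hi => (div_pos (hs.cost_pos i) (hpos i hi)).le) (fun i hi => (hpos i hi).le)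
              fun i hi => by
                rw [Real.sq_sqrt (hs.cost_pos i).le, div_mul_cancel₀ _ (hpos i hi).ne']
        _ ≤ 2 * f S' := by
            refine mul_le_mul ?_ ?_ (Finset.sum_nonneg fun i hi => (hpos i hi).le) (by norm_num)
            · refine (Finset.sum_le_sum_of_subset_of_nonneg hS'S fun i hi _ =>
                (div_pos (hs.cost_pos i) (hS.1 i hi)).le).trans (hS.2.trans (by linarith))
            · exact (Finset.sum_le_sum fun i hi => hmx i (hS'S hi)).trans (hx S')
    · exact (le_div_iff₀ hjpos).1 (Nat.floor_le (div_nonneg (hs.nonneg S') hjpos.le))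
    · have h₃ := (div_lt_iff₀ hjpos).1 (Nat.lt_floor_add_one (f S' / f {j}))
      have h₄ : (1 : ℝ) ≤ ⌊f S' / f {j}⌋₊ := by exact_mod_cast hk1
      nlinarith

end Analysis

/-! ### Correctness of the whole program. -/

section Correctness

variable {n : ℕ} {f : Finset (Fin n) → ℝ} {dem : (Fin n → ℝ) → Finset (Fin n)} {c : Fin n → ℝ}
  {a : ℝ}

/-- The values of all single agents are stored, and `HasInput` and `HasBest` hold. -/
structure HasSingles (f : Finset (Fin n) → ℝ) (c : Fin n → ℝ) (a x : ℝ) (σ : State) : Prop where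
  input : HasInput a c σ
  values : ∀ i : Fin n, σ.real 5 i = f {i}
  best : HasBest f c x σ

/-- Resetting the lower bound to the stored utility lets the next step show that this utility does
not decrease, which preserves all guarantees obtained earlier. -/
theorem HasBest.refl {x : ℝ} {σ : State} (h : HasBest f c x σ) : HasBest f c (σ.real 6 0) σ :=
  ⟨h.feasible, h.utility_eq, h.nonneg, le_rfl⟩

theorem HasBest.mono {x y : ℝ} {σ : State} (h : HasBest f c x σ) (hy : y ≤ x) :
    HasBest f c y σ :=
  ⟨h.feasible, h.utility_eq, h.nonneg, hy.trans h.le⟩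

theorem HasInput.writeNat {σ : State} (h : HasInput a c σ) {k : ℕ} (hk : k ≠ 0) (j v : ℕ) :
    HasInput a c (σ.writeNat k j v) :=
  ⟨by simp [hk.symm, h.size], h.quality, h.costs⟩

theorem HasBest.writeNat {x : ℝ} {σ : State} (h : HasBest f c x σ) {k : ℕ} (hk : k ≠ 1)
    (j v : ℕ) : HasBest f c x (σ.writeNat k j v) :=
  ⟨by simpa [hk.symm] using h.feasible, by simpa [hk.symm] using h.utility_eq, h.nonneg, h.le⟩

/-- The running time of `singleProgram`. -/
noncomputable def singleTime : Polynomial ℕ :=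
  Program.time (.seq (.setNat 2 (counter 5) (.const 1)) (.value 5 (counter 5) 2)) +
    (considerTime + Program.time (.setNat 2 (counter 5) (.const 0)))

theorem considerProgram_writes :
    (∀ l, considerProgram.WritesNat l → l = 1 ∨ l = 2 ∨ l = 4) ∧
      ∀ l, considerProgram.WritesReal l → l = 3 ∨ l = 4 ∨ l = 6 := by
  constructor <;> intro l <;>
    simp [considerProgram, shareProgram, shareBody, removeProgram, insertProgram, copyBody,
      Program.WritesNat, Program.WritesReal] <;> tauto

theorem singleProgram_writes :
    (∀ l, singleProgram.WritesNat l → l = 1 ∨ l = 2 ∨ l = 4) ∧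
      ∀ l, singleProgram.WritesReal l → l = 3 ∨ l = 4 ∨ l = 5 ∨ l = 6 := by
  obtain ⟨h₁, h₂⟩ := considerProgram_writes
  constructor <;> intro l hl
  · have := h₁ l
    simp only [singleProgram, Program.WritesNat] at hl
    tauto
  · have := h₂ l
    simp only [singleProgram, Program.WritesReal] at hl
    tauto

theorem singleProgram_runs (hs : IsSetting f c) {σ : State} {x : ℝ} {i : Fin n}
    (hin : HasInput a c σ) (hbest : HasBest f c x σ) (hset : σ.readSet n 2 = ∅)
    (hi : σ.nat 5 0 = i) :
    Runs f dem singleProgram σ singleTime fun τ => τ.readSet n 2 = ∅ ∧ HasBest f c x τ ∧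
      f {i} - c i ≤ τ.real 6 0 ∧ τ.real 5 = (σ.writeReal 5 i (f {i})).real 5 := by
  refine Runs.seq (Q₁ := fun τ => τ.readSet n 2 = {i} ∧
      τ.real 5 = (σ.writeReal 5 i (f {i})).real 5)
    (Program.LoopFree.runs (by simp [Program.LoopFree])
      (by simp [Program.run, NExpr.eval, hi, hset]; rfl)) fun τ hτ ⟨hτset, hτ5⟩ => ?_
  have hin₁ := hin.frame hτ (by simp [Program.WritesNat]) (by simp [Program.WritesReal])
    (by simp [Program.WritesReal])
  have hbest₁ := hbest.frame hτ (by simp [Program.WritesNat]) (by simp [Program.WritesReal])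
  have hτi : τ.nat 5 0 = i := by rw [hτ.nat 5 (by simp [Program.WritesNat]), hi]
  obtain ⟨hinc, hut⟩ := hs.utility_singleton i
  refine Runs.seq (considerProgram_runs hin₁ hbest₁ (by rwa [hτset]) hs.nonneg)
    fun ρ hρ ⟨hρset, hρbest, hρu⟩ => ?_
  have hw := considerProgram_writes
  have hρi : ρ.nat 5 0 = i := by
    rw [hρ.nat 5 (fun h => by have := hw.1 5 h; omega), hτi]
  have hρ5 : ρ.real 5 = τ.real 5 := hρ.real 5 fun h => by have := hw.2 5 h; omega
  refine Program.LoopFree.runs (by simp [Program.LoopFree]) ?_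
  simp only [Program.run, NExpr.eval, hρi]
  refine ⟨by simp [hρset, hτset], hρbest.writeNat (by norm_num) _ _, ?_, ?_⟩
  · rw [hτset, hut] at hρu
    exact hρu
  · rw [State.writeNat_real, hρ5, hτ5]

theorem singles_runs (hs : IsSetting f c) {σ : State} (hin : HasInput a c σ)
    (hbest : HasBest f c 0 σ) (hset : σ.readSet n 2 = ∅) :
    Runs f dem (forLoop 5 singleProgram) σ (forTime singleTime) fun τ =>
      HasSingles f c a 0 τ ∧ ∀ i, f {i} - c i ≤ τ.real 6 0 := by
  have hw := singleProgram_writes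
  refine (Runs.forLoop (I := fun k τ => τ.readSet n 2 = ∅ ∧ HasBest f c 0 τ ∧
      ∀ i : Fin n, i.val < k → τ.real 5 i = f {i} ∧ f {i} - c i ≤ τ.real 6 0) (by norm_num)
      (fun h => by have := hw.1 0 h; omega) (fun h => by have := hw.1 5 h; omega) hin.size
      ?_ ?_ ?_).imp ?_
  · rintro k w τ ⟨h₁, h₂, h₃⟩
    exact ⟨by simpa using h₁, h₂.writeNat (by norm_num) _ _, h₃⟩
  · exact ⟨hset, hbest, fun i hi => absurd hi (Nat.not_lt_zero _)⟩
  · intro i τ hi hf ⟨hτset, hτbest, hτ⟩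
    have hin' := hin.frame hf (fun h => by have := hw.1 0; simp_all)
      (fun h => by have := hw.2 0; simp_all) (fun h => by have := hw.2 1; simp_all)
    refine (singleProgram_runs hs hin' hτbest.refl hτset hi).imp
      fun ρ _ ⟨hρset, hρbest, hρu, hρ5⟩ => ⟨hρset, hρbest.mono hτbest.le, fun l hl => ?_⟩
    rw [hρ5]
    rcases Nat.lt_succ_iff_lt_or_eq.1 hl with h | h
    · exact ⟨by simp [h.ne, hτ l h], (hτ l h).2.trans hρbest.le⟩
    · obtain rfl := Fin.ext h
      exact ⟨by simp, hρu⟩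
  · rintro τ hf ⟨-, hτbest, hτ⟩
    exact ⟨⟨hin.frame hf (fun h => by have := hw.1 0; simp_all)
      (fun h => by have := hw.2 0; simp_all) (fun h => by have := hw.2 1; simp_all),
      fun i => (hτ i i.isLt).1, hτbest⟩, fun i => (hτ i i.isLt).2⟩

/-- The running time of `guessProgram`. -/
noncomputable def guessTime : Polynomial ℕ :=
  Program.time (.setReal 7 (.const 0) (.add (scalar 7) (.get 5 (counter 5)))) +
    (forTime priceBody.time + (Program.time (.demand 2 2) + (cleanTime + (forTime shrinkBody.time +
      (forTime halveBody.time + (cleanTime + considerTime))))))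

theorem guessProgram_writes :
    (∀ l, guessProgram.WritesNat l → l = 1 ∨ l = 2 ∨ l = 4) ∧
      ∀ l, guessProgram.WritesReal l → l = 2 ∨ l = 3 ∨ l = 4 ∨ l = 6 ∨ l = 7 := by
  obtain ⟨h₁, h₂⟩ := considerProgram_writes
  constructor <;> intro l hl
  · have := h₁ l
    simp [guessProgram, priceBody, cleanProgram, cleanBody, removeProgram, insertProgram,
      incrProgram, shrinkProgram, shrinkBody, halveBody, Program.WritesNat] at hl
    tauto
  · have := h₂ l
    simp [guessProgram, priceBody, cleanProgram, cleanBody, removeProgram, insertProgram,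
      incrProgram, shrinkProgram, shrinkBody, halveBody, Program.WritesReal] at hl
    tauto

theorem HasSingles.frame {x : ℝ} {σ τ : State} {P : Program} (h : HasSingles f c a x σ)
    (hf : Frame P σ τ) (h0 : ¬ P.WritesNat 0) (h1 : ¬ P.WritesNat 1) (h0' : ¬ P.WritesReal 0)
    (h1' : ¬ P.WritesReal 1) (h5 : ¬ P.WritesReal 5) (h6 : ¬ P.WritesReal 6) :
    HasSingles f c a x τ :=
  ⟨h.input.frame hf h0 h0' h1', by rw [hf.real 5 h5]; exact h.values, h.best.frame hf h1 h6⟩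

theorem HasSingles.writeNat {x : ℝ} {σ : State} (h : HasSingles f c a x σ) {k : ℕ} (hk : 1 < k)
    (j v : ℕ) : HasSingles f c a x (σ.writeNat k j v) :=
  ⟨h.input.writeNat (by omega) j v, h.values, h.best.writeNat (by omega) j v⟩

theorem guessProgram_runs (hs : IsSetting f c) (hf : IsXOS f) (ha : 0 < a) (ha1 : a ≤ 1)
    (hdem : IsDemandOracle a f dem) {σ : State} {x Y : ℝ} {j : Fin n}
    (hσ : HasSingles f c a x σ) (hj : σ.nat 5 0 = j) (hY : σ.real 7 0 + f {j} = Y) (hY0 : 0 < Y) :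
    Runs f dem guessProgram σ guessTime fun τ =>
      HasBest f c x τ ∧ τ.real 7 0 = Y ∧ GuessGood f c a j Y (τ.real 6 0) := by
  have hq0 := hs.price_pos ha hY0 j
  refine Runs.seq (Q₁ := fun τ => τ.real 7 0 = Y) (Program.LoopFree.runs (by simp [Program.LoopFree])
    (by simp [Program.run, NExpr.eval, RExpr.eval, hj, hσ.values, hY])) fun τ₁ hτ₁ h7₁ => ?_
  have h₁ := hσ.frame hτ₁ (by simp [Program.WritesNat]) (by simp [Program.WritesNat])
    (by simp [Program.WritesReal]) (by simp [Program.WritesReal]) (by simp [Program.WritesReal])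
    (by simp [Program.WritesReal])
  have hj₁ : τ₁.nat 5 0 = j := by rw [hτ₁.nat 5 (by simp [Program.WritesNat]), hj]
  refine Runs.seq (price_runs h₁.input hj₁ h₁.values h7₁) fun τ₂ hτ₂ hq₂ => ?_
  have h₂ := h₁.frame hτ₂ (by simp [priceBody, Program.WritesNat])
    (by simp [priceBody, Program.WritesNat]) (by simp [priceBody, Program.WritesReal])
    (by simp [priceBody, Program.WritesReal]) (by simp [priceBody, Program.WritesReal])
    (by simp [priceBody, Program.WritesReal])
  have h7₂ : τ₂.real 7 0 = Y := by rw [hτ₂.real 7 (by simp [priceBody, Program.WritesReal]), h7₁]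
  refine Runs.seq (Q₁ := fun τ => τ.readSet n 2 = dem (price f c a j Y))
    (Program.LoopFree.runs (by simp [Program.LoopFree]) (by simp [Program.run, hq₂]))
    fun τ₃ hτ₃ hD => ?_
  have h₃ := h₂.frame hτ₃ (by simp [Program.WritesNat]) (by simp [Program.WritesNat])
    (by simp [Program.WritesReal]) (by simp [Program.WritesReal]) (by simp [Program.WritesReal])
    (by simp [Program.WritesReal])
  have h7₃ : τ₃.real 7 0 = Y := by rw [hτ₃.real 7 (by simp [Program.WritesReal]), h7₂]
  have hq₃ : τ₃.readVec n 2 = price f c a j Y := by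
    rw [← hq₂]
    exact State.readVec_congr (hτ₃.real 2 (by simp [Program.WritesReal])) n
  have hcl : (¬ cleanProgram.WritesNat 0 ∧ ¬ cleanProgram.WritesNat 1) ∧
      ∀ l, cleanProgram.WritesReal l → l = 3 := by
    simp [cleanProgram, cleanBody, removeProgram, insertProgram, incrProgram, Program.WritesNat,
      Program.WritesReal]
  have hcl' : ∀ l, l ≠ 3 → ¬ cleanProgram.WritesReal l := fun l hl h => hl (hcl.2 l h)
  refine Runs.seq (cleanProgram_runs h₃.input.size) fun τ₄ hτ₄ ⟨hDD, hD', hDD'⟩ => ?_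
  rw [hq₃] at hD' hDD'
  rw [hD] at hDD hDD'
  have h₄ := h₃.frame hτ₄ hcl.1.1 hcl.1.2 (hcl' 0 (by norm_num)) (hcl' 1 (by norm_num))
    (hcl' 5 (by norm_num)) (hcl' 6 (by norm_num))
  have h7₄ : τ₄.real 7 0 = Y := by rw [hτ₄.real 7 (hcl' 7 (by norm_num)), h7₃]
  have hq₄ : τ₄.readVec n 2 = price f c a j Y := by
    rw [← hq₃]
    exact State.readVec_congr (hτ₄.real 2 (hcl' 2 (by norm_num))) n
  have hM0 : 0 ≤ a * a * Y / 72 := by positivity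
  have hsh : (¬ shrinkProgram.WritesNat 0 ∧ ¬ shrinkProgram.WritesNat 1) ∧
      ∀ l, shrinkProgram.WritesReal l → l = 3 := by
    simp [shrinkProgram, shrinkBody, Program.WritesNat, Program.WritesReal]
  have hsh' : ∀ l, l ≠ 3 → ¬ shrinkProgram.WritesReal l := fun l hl h => hl (hsh.2 l h)
  refine Runs.seq (shrinkProgram_runs (M := a * a * Y / 72) (m := f {j}) h₄.input.size hs.empty
    (hs.le_erase_add hf) (by rw [h₄.input.quality, h7₄]) hM0
    fun i hi => hs.value_le_of_price_le hf hi (hD' i hi)) fun τ₅ hτ₅ ⟨hT, hTM, hTlow⟩ => ?_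
  have h₅ := h₄.frame hτ₅ hsh.1.1 hsh.1.2 (hsh' 0 (by norm_num)) (hsh' 1 (by norm_num))
    (hsh' 5 (by norm_num)) (hsh' 6 (by norm_num))
  have h7₅ : τ₅.real 7 0 = Y := by rw [hτ₅.real 7 (hsh' 7 (by norm_num)), h7₄]
  have hq₅ : τ₅.readVec n 2 = price f c a j Y := by
    rw [← hq₄]
    exact State.readVec_congr (hτ₅.real 2 (hsh' 2 (by norm_num))) n
  refine Runs.seq (halve_runs h₅.input.size) fun τ₆ hτ₆ hq₆ => ?_
  rw [hq₅] at hq₆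
  have h₆ := h₅.frame hτ₆ (by simp [halveBody, Program.WritesNat])
    (by simp [halveBody, Program.WritesNat]) (by simp [halveBody, Program.WritesReal])
    (by simp [halveBody, Program.WritesReal]) (by simp [halveBody, Program.WritesReal])
    (by simp [halveBody, Program.WritesReal])
  have h7₆ : τ₆.real 7 0 = Y := by rw [hτ₆.real 7 (by simp [halveBody, Program.WritesReal]), h7₅]
  have hT₆ : τ₆.readSet n 2 = τ₅.readSet n 2 :=
    State.readSet_congr (hτ₆.nat 2 (by simp [halveBody, Program.WritesNat])) n
  refine Runs.seq (cleanProgram_runs h₆.input.size) fun τ₇ hτ₇ ⟨hUT, hU, hTU⟩ => ?_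
  rw [hT₆] at hUT hTU
  rw [hq₆] at hU hTU
  have h₇ := h₆.frame hτ₇ hcl.1.1 hcl.1.2 (hcl' 0 (by norm_num)) (hcl' 1 (by norm_num))
    (hcl' 5 (by norm_num)) (hcl' 6 (by norm_num))
  have h7₇ : τ₇.real 7 0 = Y := by rw [hτ₇.real 7 (hcl' 7 (by norm_num)), h7₆]
  -- Half prices are positive and bound the marginals from below.
  have hinc : Incentivizable f (τ₇.readSet n 2) :=
    fun i hi => (half_pos (hq0 i)).trans_le (hU i hi)
  refine (considerProgram_runs h₇.input h₇.best hinc hs.nonneg).imp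
    fun τ hτ ⟨_, hbest, hu⟩ => ⟨hbest, ?_, ?_⟩
  · rw [hτ.real 7 (fun h => by have := considerProgram_writes.2 7 h; omega), h7₇]
  · exact (GuessGood.of_steps hs hf ha ha1 hY0 rfl (hdem _ fun i => (hq0 i).le) hD' hDD' hT hTM
      hTlow hUT hU hTU).mono hu

/-- The running time of `guessesProgram`. -/
noncomputable def guessesTime : Polynomial ℕ :=
  Program.time (.setReal 7 (.const 0) (.const 0)) + forTime guessTime

theorem guessesProgram_runs (hs : IsSetting f c) (hf : IsXOS f) (ha : 0 < a) (ha1 : a ≤ 1)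
    (hdem : IsDemandOracle a f dem) {σ : State} {x : ℝ} {j : Fin n}
    (hσ : HasSingles f c a x σ) (hj : σ.nat 5 0 = j) :
    Runs f dem guessesProgram σ guessesTime fun τ => HasSingles f c a x τ ∧
      ∀ k : ℕ, 1 ≤ k → k ≤ n → GuessGood f c a j (k * f {j}) (τ.real 6 0) := by
  have hw := guessProgram_writes
  have hw0 : ∀ l, l ≠ 1 → l ≠ 2 → l ≠ 4 → ¬ guessProgram.WritesNat l :=
    fun l h₁ h₂ h₃ h => by have := hw.1 l h; tauto
  refine Runs.seq (Q₁ := fun τ => τ.real 7 0 = 0) (Program.LoopFree.runs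
    (by simp [Program.LoopFree]) (by simp [Program.run, NExpr.eval, RExpr.eval]))
    fun τ hτ h7 => ?_
  have hτσ := hσ.frame hτ (by simp [Program.WritesNat]) (by simp [Program.WritesNat])
    (by simp [Program.WritesReal]) (by simp [Program.WritesReal]) (by simp [Program.WritesReal])
    (by simp [Program.WritesReal])
  have hjτ : τ.nat 5 0 = j := by rw [hτ.nat 5 (by simp [Program.WritesNat]), hj]
  refine (Runs.forLoop (I := fun m ρ => HasSingles f c a x ρ ∧ ρ.real 7 0 = m * f {j} ∧
      ∀ k : ℕ, 1 ≤ k → k ≤ m → GuessGood f c a j (k * f {j}) (ρ.real 6 0)) (by norm_num)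
      (hw0 0 (by norm_num) (by norm_num) (by norm_num))
      (hw0 6 (by norm_num) (by norm_num) (by norm_num)) hτσ.input.size ?_ ?_ ?_).imp ?_
  · rintro m w ρ ⟨h₁, h₂⟩
    exact ⟨h₁.writeNat (by norm_num) _ _, h₂⟩
  · exact ⟨hτσ, by simp [h7], fun k h₁ h₂ => by omega⟩
  · intro i ρ _ hρ ⟨hρσ, h7ρ, hgood⟩
    have hjρ : ρ.nat 5 0 = j := by
      rw [hρ.nat 5 (by
        rw [forLoop_writesNat]
        exact not_or.2 ⟨by norm_num, hw0 5 (by norm_num) (by norm_num) (by norm_num)⟩), hjτ]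
    have hpos := hs.value_pos j
    -- Each round adds `f {j}` before using the guess, so counter value `i` belongs to `k = i + 1`.
    refine (guessProgram_runs hs hf ha ha1 hdem ⟨hρσ.input, hρσ.values, hρσ.best.refl⟩ hjρ
      (Y := ((i.val + 1 : ℕ) : ℝ) * f {j}) (by rw [h7ρ]; push_cast; ring) (by positivity)).imp
      fun ρ' hf' ⟨hbest, h7', hgood'⟩ => ⟨⟨?_, ?_, hbest.mono hρσ.best.le⟩, h7', ?_⟩
    · exact hρσ.input.frame hf' (hw0 0 (by norm_num) (by norm_num) (by norm_num))
        (fun h => by have := hw.2 0 h; omega) (fun h => by have := hw.2 1 h; omega)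
    · rw [hf'.real 5 (fun h => by have := hw.2 5 h; omega)]
      exact hρσ.values
    · intro k hk hki
      rcases Nat.le_succ_iff.1 hki with h | rfl
      · exact (hgood k hk h).mono hbest.le
      · exact hgood'
  · rintro ρ - ⟨h₁, -, h₂⟩
    exact ⟨h₁, h₂⟩

theorem contractProgram_runs (hs : IsSetting f c) (hf : IsXOS f) (ha : 0 < a) (ha1 : a ≤ 1)
    (hdem : IsDemandOracle a f dem) :
    Runs f dem contractProgram (inputState a c) (forTime singleTime + forTime guessesTime)
      fun τ => HasBest f c 0 τ ∧ (∀ i, f {i} - c i ≤ τ.real 6 0) ∧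
        ∀ (j : Fin n) (k : ℕ), 1 ≤ k → k ≤ n → GuessGood f c a j (k * f {j}) (τ.real 6 0) := by
  have hset : ∀ s, s ≠ 0 → (inputState a c).readSet n s = ∅ := fun s h => by
    simp [State.readSet, inputState, h]
  have hin : HasInput a c (inputState a c) :=
    ⟨by simp [inputState], by simp [inputState], by simp [inputState]⟩
  have hbest : HasBest f c 0 (inputState a c) := by
    have h6 : (inputState a c).real 6 0 = 0 := by simp [inputState]
    refine ⟨?_, ?_, h6.ge, h6.ge⟩
    · rw [hset 1 (by norm_num)]
      exact ⟨by simp [Incentivizable], by simp [share]⟩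
    · rw [hset 1 (by norm_num), h6]
      simp [utility, hs.empty]
  have hw : ∀ l, l ≠ 1 → l ≠ 2 → l ≠ 4 → l ≠ 6 → ¬ guessesProgram.WritesNat l := by
    intro l h₁ h₂ h₃ h₄ h
    have := guessProgram_writes.1 l
    simp only [guessesProgram, Program.WritesNat, forLoop_writesNat] at h
    tauto
  refine Runs.seq (singles_runs hs hin hbest (hset 2 (by norm_num))) fun τ _ ⟨hτ, hsingle⟩ => ?_
  refine (Runs.forLoop (I := fun m ρ => HasSingles f c a (τ.real 6 0) ρ ∧
      ∀ j : Fin n, j.val < m → ∀ k : ℕ, 1 ≤ k → k ≤ n →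
        GuessGood f c a j (k * f {j}) (ρ.real 6 0)) (by norm_num)
      (hw 0 (by norm_num) (by norm_num) (by norm_num) (by norm_num))
      (hw 5 (by norm_num) (by norm_num) (by norm_num) (by norm_num)) hτ.input.size ?_ ?_ ?_).imp ?_
  · rintro m w ρ ⟨h₁, h₂⟩
    exact ⟨h₁.writeNat (by norm_num) _ _, h₂⟩
  · exact ⟨⟨hτ.input, hτ.values, hτ.best.refl⟩, fun j hj => absurd hj (Nat.not_lt_zero _)⟩
  · intro i ρ hi _ ⟨hρ, hgood⟩
    refine (guessesProgram_runs hs hf ha ha1 hdem ⟨hρ.input, hρ.values, hρ.best.refl⟩ hi).imp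
      fun ρ' _ ⟨hρ', hgood'⟩ => ⟨⟨hρ'.input, hρ'.values, hρ'.best.mono hρ.best.le⟩, ?_⟩
    intro j hj k hk hkn
    rcases Nat.lt_succ_iff_lt_or_eq.1 hj with h | h
    · exact (hgood j h k hk hkn).mono hρ'.best.le
    · obtain rfl := Fin.ext h
      exact hgood' k hk hkn
  · rintro ρ - ⟨hρ, hgood⟩
    exact ⟨hρ.best.mono hτ.best.le, fun i => (hsingle i).trans hρ.best.le,
      fun j => hgood j j.isLt⟩

end Correctness

end ContractDesign

theorem mainTheorem12 :
    ∃ (P : ContractDesign.Program) (T : Polynomial ℕ),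
      ∀ a : ℝ, 0 < a → a ≤ 1 → ∀ η : ℝ, 0 < η →
        ∃ C : ℝ, 0 < C ∧
          ∀ (n : ℕ) (f : Finset (Fin n) → ℝ) (c : Fin n → ℝ)
            (dem : (Fin n → ℝ) → Finset (Fin n)),
            ContractDesign.IsSetting f c → ContractDesign.IsXOS f →
            ContractDesign.IsDemandOracle a f dem →
            ∃ U : Finset (Fin n),
              ContractDesign.Outputs P f dem a c (T.eval n) U ∧
              ContractDesign.BFeasible f c 1 U ∧
              ∀ b : ℝ, 1 ≤ b → b ≤ 2 - η →
                ContractDesign.optWelfare f c b ≤ C * ContractDesign.utility f c U := by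
  refine ⟨ContractDesign.contractProgram, ContractDesign.forTime ContractDesign.singleTime +
    ContractDesign.forTime ContractDesign.guessesTime, fun a ha ha1 η hη =>
    ⟨1 + 768 / a ^ 2 + 864 / (η * a ^ 2), by positivity, fun n f c dem hs hf hdem => ?_⟩⟩
  obtain ⟨t, τ, he, ht, hbest, hsingle, hguess⟩ :=
    ContractDesign.contractProgram_runs hs hf ha ha1 hdem
  refine ⟨τ.readSet n 1, ⟨t, τ, he, ht, rfl⟩, hbest.feasible, fun b hb1 hb => ?_⟩
  obtain ⟨S, hS, hSw⟩ :=
    (ContractDesign.isGreatest_optWelfare f c (zero_le_one.trans hb1)).1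
  rw [← hSw, hbest.utility_eq]
  exact ContractDesign.welfare_le hs hf ha hη hb1 hb hbest.nonneg hsingle hguess hS
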